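/- **Setting.** Let $X$ be a measurable input space and $Y$ a measurable label space (with measurable diagonal), with the 0-1 loss $l(y,y')=\mathbf 1[y\neq y']$ (which is $|y-y'|$ when $Y=\{0,1\}$). For a distribution $P$ on $X\times Y$, a hypothesis $h:X\to Y$ and a hypothesis space $H$, put $err_P(h)=\int l(h(x),y)\,dP(x,y)$ and $err_P(H)=\inf_{h\in H}err_P(h)$. Let $Q$ be a probability distribution on the set of distributions on $X\times Y$ and $err_Q(H)=\int err_P(H)\,dQ(P)$. The training sample $z=(z_1,\dots,z_n)$ is obtained by drawing clients $P_1,\dots,P_n$ independently from $Q$ and then, for each $i$, $m$ independent points $z_i=((x_{i1},y_{i1}),\dots,(x_{im},y_{im}))$ from $P_i$; the multitask empirical error is $$\widehat{err}_z(H)=\frac1n\sum_{i=1}^n\inf_{h\in H}\frac1m\sum_{j=1}^m l(h(x_{ij}),y_{ij}).$$ For distributions $P,P'$ on $X\times Y$ let $$d_{H\Delta H}(P,P')=2\sup_{h,h'\in H}\bigl|\Pr\nolimits_{P}[h(x)\ne h'(x)]-\Pr\nolimits_{P'}[h(x)\neq h'(x)]\bigr|,\qquad \lambda_H(P,P')=\inf_{h\in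 H}\bigl(err_P(h)+err_{P'}(h)\bigr).$$ Let $\mathbb H$ be a family of nonempty hypothesis spaces that is permissible: $\mathbb H=\{H_s:s\in S\}$, $H_s=\{f(s,t,\cdot):t\in T\}$, with $S,T$ standard Borel, $f:S\times T\times X\to Y$ measurable, and $(s,P)\mapsto err_P(H_s)$ measurable. Define the capacities $$C(r,\mathbb H^*)=\sup_{Q'}N\bigl(r,\mathbb H,d_{Q'}\bigr),\qquad C(r,\mathbb H^n_l)=\sup_{P_1,\dots,P_n}N\bigl(r,\textstyle\bigcup_{H\in\mathbb H}H^n,d_{P_1,\dots,P_n}\bigr),$$ where $N$ is the least cardinality of an $r$-cover by points of the set itself, $d_{Q'}(H,H')=\int|err_P(H)-err_P(H')|\,dQ'(P)$, $d_{P_1,\dots,P_n}(\mathbf h,\mathbf h')=\frac1n\sum_i\int|l(h_i(x),y)-l(h_i'(x),y)|\,dP_i(x,y)$, and the suprema are over all probability distributions on the set of distributions on $X\times Y$, respectively all $n$-tuples of distributions on $X\times Y$. **Theorem.** Let $\varepsilon,\delta>0$, suppose that $C(\frac\varepsilon{32},\mathbb H^*)$ and $C(\frac\varepsilon{32},\mathbb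 H^n_l)$ are finite, and $$n\ge\max\Bigl\{\frac{256}{\varepsilon^2}\log\frac{8\,C(\frac{\varepsilon}{32},\mathbb H^*)}{\delta},\frac{64}{\varepsilon^2}\Bigr\},\qquad m\ge\max\Bigl\{\frac{256}{n\varepsilon^2}\log\frac{8\,C(\frac{\varepsilon}{32},\mathbb H^n_l)}{\delta},\frac{64}{\varepsilon^2}\Bigr\}.$$ 1. For all $H\in\mathbb H$ and all distributions $P_{new}$ on $X\times Y$, the functions $P\mapsto err_P(H)$, $P\mapsto d_{H\Delta H}(P,P_{new})$ and $P\mapsto\lambda_H(P,P_{new})$ are $Q$-integrable, and for all distributions $P$ and all $h\in H$, $$err_{P_{new}}(h)\le err_P(h)+\tfrac12 d_{H\Delta H}(P,P_{new})+\lambda_H(P,P_{new}).$$ 2. Outside a set of samples $z$ of (outer) probability at most $\delta$, every $H\in\mathbb H$ satisfies $err_Q(H)\le\widehat{err}_z(H)+\varepsilon$ and, for every distribution $P_{new}$ of a novel client, * (a) $\displaystyle err_{P_{new}}(H)\le\widehat{err}_z(H)+\varepsilon+\frac12\int d_{H\Delta H}(P,P_{new})\,dQ(P)+\int\lambda_H(P,P_{new})\,dQ(P)$;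 * (b) in particular, if the $\lambda$ term is null, i.e. $\lambda_H(P,P_{new})=0$ for $Q$-almost every $P$, then $\displaystyle err_{P_{new}}(H)\le\widehat{err}_z(H)+\varepsilon+\frac12\int d_{H\Delta H}(P,P_{new})\,dQ(P)$; * (c) more generally, if $\eta\in\mathbb R$ and $h_P\in H$ satisfies $err_P(h_P)\le err_P(H)+\eta$ for $Q$-almost every $P$, and $P\mapsto err_{P_{new}}(h_P)$ is $Q$-integrable, then $\int err_{P_{new}}(h_P)\,dQ(P)$ is at most the right-hand side of (a) plus $\eta$. -/

import Mathlib

open MeasureTheory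

namespace FedGen

noncomputable section

variable {X Y : Type*}

open Classical in
/-- The 0-1 loss. For labels in `{0, 1}` this is `|y - y'|`. -/
def zeroOneLoss (y y' : Y) : ℝ := if y = y' then 0 else 1

/-- The error `err_P(h) = ∫ l(h(x), y) dP(x, y)` of a hypothesis on a data distribution. -/
def err [MeasurableSpace X] [MeasurableSpace Y] (P : ProbabilityMeasure (X × Y))
    (h : X → Y) : ℝ :=
  ∫ z, zeroOneLoss (h z.1) z.2 ∂(P : Measure (X × Y))

/-- The error `err_P(H) = inf_{h ∈ H} err_P(h)` of a hypothesis space on a data distribution. -/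
def errSpace [MeasurableSpace X] [MeasurableSpace Y] (P : ProbabilityMeasure (X × Y))
    (H : Set (X → Y)) : ℝ :=
  ⨅ h : H, err P h.1

/-- The multitask error `err_Q(H) = ∫ inf_{h ∈ H} err_P(h) dQ(P)`. -/
def errQ [MeasurableSpace X] [MeasurableSpace Y] (Q : Measure (ProbabilityMeasure (X × Y)))
    (H : Set (X → Y)) : ℝ :=
  ∫ P, errSpace P H ∂Q

/-- The empirical error of a hypothesis on the labelled sample of one client. -/
def empErr {m : ℕ} (z : Fin m → X × Y) (h : X → Y) : ℝ :=
  (1 / (m : ℝ)) * ∑ j, zeroOneLoss (h (z j).1) (z j).2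

/-- The multitask empirical error of a hypothesis space: the average over the `n` training clients
of the smallest empirical error on the client's sample. -/
def empErrSpace {n m : ℕ} (z : Fin n → Fin m → X × Y) (H : Set (X → Y)) : ℝ :=
  (1 / (n : ℝ)) * ∑ i, ⨅ h : H, empErr (z i) h.1

/-- The law of the sample of one client: draw `P` from `Q`, then `m` independent points from `P`. -/
def clientLaw [MeasurableSpace X] [MeasurableSpace Y] (Q : Measure (ProbabilityMeasure (X × Y)))
    (m : ℕ) : Measure (Fin m → X × Y) :=
  Q.bind fun P => Measure.pi fun _ : Fin m => (P : Measure (X × Y))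

/-- The law of the `(n, m)`-sample: `P_1, …, P_n` are drawn independently from `Q`, and then, for
each `i`, `m` independent points are drawn from `P_i`. -/
def sampleLaw [MeasurableSpace X] [MeasurableSpace Y] (Q : Measure (ProbabilityMeasure (X × Y)))
    (n m : ℕ) : Measure (Fin n → Fin m → X × Y) :=
  Measure.pi fun _ : Fin n => clientLaw Q m

/-- The `H Δ H`-divergence of two distributions on the input space: twice the supremum, over the
disagreement sets `{x | h x ≠ h' x}` of pairs of hypotheses in `H`, of the absolute difference of
their probabilities. -/
def divHDH [MeasurableSpace X] (H : Set (X → Y)) (D D' : Measure X) : ℝ :=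
  2 * ⨆ p : H × H, |D.real {x | p.1.1 x ≠ p.2.1 x} - D'.real {x | p.1.1 x ≠ p.2.1 x}|

/-- The error `λ` of the ideal joint hypothesis for two data distributions. -/
def jointErr [MeasurableSpace X] [MeasurableSpace Y] (H : Set (X → Y))
    (P P' : ProbabilityMeasure (X × Y)) : ℝ :=
  ⨅ h : H, (err P h.1 + err P' h.1)

/-- The least cardinality of an `r`-cover of `A`, with centres in `A`, for a (pseudo-)distance `d`
(`⊤` if there is no finite one). -/
def coverNum {α : Type*} (d : α → α → ℝ) (A : Set α) (r : ℝ) : ℕ∞ :=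
  ⨅ (C : Set α) (_ : C ⊆ A) (_ : ∀ a ∈ A, ∃ c ∈ C, d a c ≤ r), C.encard

/-- The `n`-tuples of hypotheses that come from a common hypothesis space of the family. -/
def tuples (ℍ : Set (Set (X → Y))) (n : ℕ) : Set (Fin n → X → Y) :=
  {h | ∃ H ∈ ℍ, ∀ i, h i ∈ H}

/-- The `L¹` distance of the losses of two `n`-tuples of hypotheses, averaged over the tasks. -/
def tupleDist [MeasurableSpace X] [MeasurableSpace Y] {n : ℕ}
    (P : Fin n → ProbabilityMeasure (X × Y)) (h h' : Fin n → X → Y) : ℝ :=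
  (1 / (n : ℝ)) * ∑ i, ∫ z, |zeroOneLoss (h i z.1) z.2 - zeroOneLoss (h' i z.1) z.2|
    ∂(P i : Measure (X × Y))

/-- The capacity `C(r, ℍ_l^n)` of the class of losses of `n`-tuples of hypotheses. -/
def capTuples [MeasurableSpace X] [MeasurableSpace Y] (ℍ : Set (Set (X → Y))) (n : ℕ)
    (r : ℝ) : ℕ∞ :=
  ⨆ P : Fin n → ProbabilityMeasure (X × Y), coverNum (tupleDist P) (tuples ℍ n) r

/-- The `L¹(Q)` distance of the functions `P ↦ inf_{h ∈ H} err_P(h)` of two hypothesis spaces. -/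
def spaceDist [MeasurableSpace X] [MeasurableSpace Y]
    (Q : Measure (ProbabilityMeasure (X × Y))) (H H' : Set (X → Y)) : ℝ :=
  ∫ P, |errSpace P H - errSpace P H'| ∂Q

/-- The capacity `C(r, ℍ^*)` of the class of functions `P ↦ inf_{h ∈ H} err_P(h)`, `H ∈ ℍ`. -/
def capStar [MeasurableSpace X] [MeasurableSpace Y] (ℍ : Set (Set (X → Y))) (r : ℝ) : ℕ∞ :=
  ⨆ Q : ProbabilityMeasure (ProbabilityMeasure (X × Y)),
    coverNum (spaceDist (Q : Measure (ProbabilityMeasure (X × Y)))) ℍ r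

/-- Permissibility, the standard measurability assumption on a family of hypothesis spaces: the
spaces are the nonempty sets `H_s = {f s t | t}` for a jointly measurable parametrization by
standard Borel spaces, and the functions `(s, P) ↦ inf_{h ∈ H_s} err_P(h)` are measurable. -/
def Permissible [MeasurableSpace X] [MeasurableSpace Y] (ℍ : Set (Set (X → Y))) : Prop :=
  ∃ (S T : Type) (_ : MeasurableSpace S) (_ : StandardBorelSpace S)
    (_ : MeasurableSpace T) (_ : StandardBorelSpace T) (_ : Nonempty T) (f : S → T → X → Y),
    Measurable (fun p : S × T × X => f p.1 p.2.1 p.2.2) ∧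
    Measurable (fun p : S × ProbabilityMeasure (X × Y) => errSpace p.2 (Set.range (f p.1))) ∧
    ℍ = Set.range fun s => Set.range (f s)

end

end FedGen

/-!
The probabilistic part of the theorem is a uniform bound: outside a set of samples of probability at
most `δ`, `err_Q(H)` exceeds the multitask empirical error of `H` by at most `ε` for all `H ∈ ℍ`.
The bounds for a novel client follow deterministically. Two triangle inequalities through a joint
hypothesis (`FedGen.err_le_err_add_divHDH_add_jointErr`) bound the error on the novel client by the
error on a client `P`, half the divergence and `λ`, and the result is integrated over `Q`.

The uniform bound is split at the average of `err_{P_i}(H)` over the training clients, with `ε / 2`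
and `δ / 2` for each half. From `err_Q(H)` to this average
(`FedGen.measure_exists_errQ_deviation_le`) the class consists of the functions
`P ↦ err_P(H)`, evaluated at `n` independent clients. From the average to the empirical error
(`FedGen.measure_exists_empErrSpace_deviation_le`) the clients are fixed, and the class consists of
the losses of `n`-tuples of hypotheses from a common space, evaluated at `n * m` independent points:
an infimum over `H` for each client is undercut by a tuple of hypotheses. Both halves are instances
of `measure_pi_exists_half_eps_deviation_le`, which is the classical symmetrization argument: a
ghost sample, introduced with Chebyshev's inequality; random swaps between the two samples, which
preserve the product measure; and, for a fixed double sample, Hoeffding's inequality for random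
signs and the union bound over an `L¹` cover for the uniform distribution on the double sample. The
capacities bound the covers for all distributions, in particular for this one.

Suprema and infima over uncountable families are not measurable for free. The bad events are
projections of measurable sets along the standard Borel parameter spaces, hence universally
measurable (`MeasurableSet.nullMeasurableSet_exists`). As the sample spaces are arbitrary, this is
reduced to analytic subsets of standard Borel spaces, and for those it is the capacitability theorem
`exists_isCompact_subset_range_measure_ge`. The same fact makes the divergence and `λ` integrable.
-/

/-! ### Universal measurability of projections -/

open Set Filter Topology in
/-- Capacitability of analytic sets: the outer measure of a continuous image of the Baire space is
approximated from inside by compact sets. The coordinates of the Baire space are bounded one after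
the other, which costs little because an outer measure is continuous along increasing unions. -/
theorem exists_isCompact_subset_range_measure_ge {α : Type*} [TopologicalSpace α] [T2Space α]
    [MeasurableSpace α] [BorelSpace α] (μ : Measure α) [IsFiniteMeasure μ]
    {f : (ℕ → ℕ) → α} (hf : Continuous f) {c : ENNReal} (hc : c < μ (range f)) :
    ∃ K ⊆ range f, IsCompact K ∧ c ≤ μ K := by
  let Box : (ℕ → ℕ) → ℕ → Set (ℕ → ℕ) := fun N k => {x | ∀ i < k, x i ≤ N i}
  have box_zero : ∀ N, Box N 0 = univ := fun N => by ext; simp [Box]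
  have step : ∀ (k : ℕ) (N : ℕ → ℕ), c < μ (f '' Box N k) →
      ∃ j, c < μ (f '' Box (Function.update N k j) (k + 1)) := by
    intro k N h
    have hU : f '' Box N k = ⋃ j, f '' Box (Function.update N k j) (k + 1) := by
      rw [← image_iUnion]
      congr 1
      ext x
      simp only [Box, mem_ofPred_eq, mem_iUnion]
      constructor
      · intro hx
        refine ⟨x k, fun i hi => ?_⟩
        rcases Nat.lt_succ_iff_lt_or_eq.1 hi with hi | rfl
        · rw [Function.update_of_ne hi.ne]; exact hx i hi
        · simp
      · rintro ⟨j, hj⟩ i hi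
        have := hj i (by omega)
        rwa [Function.update_of_ne hi.ne] at this
    have hmono : Monotone fun j => f '' Box (Function.update N k j) (k + 1) := by
      intro a b hab
      refine image_mono fun x hx i hi => (hx i hi).trans ?_
      rcases eq_or_ne i k with rfl | hik
      · simpa using hab
      · simp [Function.update_of_ne hik]
    rw [hU, hmono.measure_iUnion] at h
    exact lt_iSup_iff.1 h
  choose! J hJ using step
  let seq : ∀ k, {N : ℕ → ℕ // c < μ (f '' Box N k)} := fun k =>
    Nat.rec (motive := fun k => {N : ℕ → ℕ // c < μ (f '' Box N k)})
      ⟨0, by rw [box_zero, image_univ]; exact hc⟩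
      (fun k N => ⟨Function.update N.1 k (J k N.1), hJ k N.1 N.2⟩) k
  have seq_succ : ∀ k, (seq (k + 1)).1 = Function.update (seq k).1 k (J k (seq k).1) :=
    fun k => rfl
  let n : ℕ → ℕ := fun i => (seq (i + 1)).1 i
  have hn : ∀ k, ∀ i < k, (seq k).1 i = n i := by
    intro k
    induction k with
    | zero => intro i hi; omega
    | succ k ih =>
      intro i hi
      rcases Nat.lt_succ_iff_lt_or_eq.1 hi with hi | rfl
      · rw [seq_succ, Function.update_of_ne hi.ne]; exact ih i hi
      · rfl
  have hbox : ∀ k, c < μ (f '' Box n k) := by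
    intro k
    have : Box n k = Box (seq k).1 k := by
      ext x
      exact forall₂_congr fun i hi => by rw [hn k i hi]
    rw [this]
    exact (seq k).2
  have hKc : IsCompact {x : ℕ → ℕ | ∀ i, x i ≤ n i} := by
    have : {x : ℕ → ℕ | ∀ i, x i ≤ n i} = pi univ fun i => Iic (n i) := by
      ext; simp [Pi.le_def]
    rw [this]
    exact isCompact_univ_pi fun i => (finite_Iic (n i)).isCompact
  -- a neighbourhood of the compact box contains one of the boxes that bound finitely many
  -- coordinates
  have tube : ∀ U : Set (ℕ → ℕ), IsOpen U → {x : ℕ → ℕ | ∀ i, x i ≤ n i} ⊆ U →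
      ∃ k, Box n k ⊆ U := by
    intro U hU hKU
    obtain ⟨k, hk⟩ : ∃ k, ∀ w ∈ {x : ℕ → ℕ | ∀ i, x i ≤ n i}, ∀ z : ℕ → ℕ,
        (∀ i < k, z i = w i) → z ∈ U := by
      refine hKc.induction_on (p := fun s => ∃ k, ∀ w ∈ s, ∀ z : ℕ → ℕ,
        (∀ i < k, z i = w i) → z ∈ U) ⟨0, by simp⟩ ?_ ?_ ?_
      · rintro s t hst ⟨k, hk⟩
        exact ⟨k, fun w hw => hk w (hst hw)⟩
      · rintro s t ⟨k, hk⟩ ⟨l, hl⟩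
        refine ⟨max k l, fun w hw z hz => ?_⟩
        rcases hw with hw | hw
        · exact hk w hw z fun i hi => hz i (lt_max_of_lt_left hi)
        · exact hl w hw z fun i hi => hz i (lt_max_of_lt_right hi)
      · intro x hx
        obtain ⟨I, u, hu, hIu⟩ := isOpen_pi_iff.1 hU x (hKU hx)
        refine ⟨(I : Set ℕ).pi fun i => {x i}, mem_nhdsWithin_of_mem_nhds
          (set_pi_mem_nhds I.finite_toSet fun i _ => by simp), I.sup id + 1, ?_⟩
        intro w hw z hz
        refine hIu fun i hi => ?_
        have h1 : i ≤ I.sup id := Finset.le_sup (f := id) hi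
        rw [hz i (by omega), hw i hi]
        exact (hu i hi).2
    refine ⟨k, fun z hz => hk (fun i => min (z i) (n i)) (fun i => min_le_right _ _) z
      fun i hi => ?_⟩
    exact (min_eq_left (hz i hi)).symm
  refine ⟨f '' {x | ∀ i, x i ≤ n i}, image_subset_range _ _, hKc.image hf, ?_⟩
  have hinter : ⋂ k, closure (f '' Box n k) ⊆ f '' {x | ∀ i, x i ≤ n i} := by
    intro y hy
    by_contra hyK
    obtain ⟨U, V, hU, hV, hKU, hyV, hUV⟩ :=
      (hKc.image hf).separation_of_notMem hyK
    obtain ⟨k, hk⟩ := tube (f ⁻¹' U) (hU.preimage hf) (image_subset_iff.1 hKU)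
    obtain ⟨z, hzV, hz⟩ := mem_closure_iff.1 (mem_iInter.1 hy k) V hV hyV
    exact hUV.le_bot ⟨image_subset_iff.2 hk hz, hzV⟩
  have hanti : Antitone fun k => closure (f '' Box n k) := fun a b hab =>
    closure_mono (image_mono fun x hx i hi => hx i (hi.trans_le hab))
  refine le_trans ?_ (measure_mono hinter)
  refine ge_of_tendsto' (tendsto_measure_iInter_atTop
    (fun k => isClosed_closure.measurableSet.nullMeasurableSet) hanti
    ⟨0, measure_ne_top _ _⟩) fun k => ?_
  exact (hbox k).le.trans (measure_mono subset_closure)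

/-- Analytic sets are universally measurable. -/
theorem MeasureTheory.AnalyticSet.nullMeasurableSet {α : Type*} [TopologicalSpace α] [T2Space α]
    [MeasurableSpace α] [BorelSpace α] {s : Set α} (hs : AnalyticSet s) (μ : Measure α)
    [IsFiniteMeasure μ] : NullMeasurableSet s μ := by
  rcases eq_or_ne (μ s) 0 with h0 | h0
  · exact NullMeasurableSet.of_null h0
  rw [AnalyticSet] at hs
  rcases hs with rfl | ⟨f, hf, rfl⟩
  · exact nullMeasurableSet_empty
  obtain ⟨c, -, hc, hlim⟩ := exists_seq_strictMono_tendsto' (pos_iff_ne_zero.2 h0)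
  choose K hKs hKc hK using fun k =>
    exists_isCompact_subset_range_measure_ge μ hf (hc k).2
  have hM : MeasurableSet (⋃ k, K k) := MeasurableSet.iUnion fun k => (hKc k).measurableSet
  refine NullMeasurableSet.congr hM.nullMeasurableSet
    (ae_eq_of_subset_of_measure_ge (Set.iUnion_subset hKs) ?_ hM.nullMeasurableSet
      (measure_ne_top _ _))
  exact le_of_tendsto' hlim fun k =>
    (hK k).trans (measure_mono (Set.subset_iUnion K k))

/-- A measurable set in a product depends on the second factor only through a measurable map into
a standard Borel space, since it lies in the σ-algebra generated by countably many rectangles. -/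
theorem exists_standardBorel_preimage_eq {S Ω : Type*} [MeasurableSpace S] [MeasurableSpace Ω]
    {E : Set (S × Ω)} (hE : MeasurableSet E) :
    ∃ (W : Type) (_ : MeasurableSpace W) (_ : StandardBorelSpace W) (φ : Ω → W)
      (E' : Set (S × W)), Measurable φ ∧ MeasurableSet E' ∧ E = Prod.map id φ ⁻¹' E' := by
  classical
  have hE0 := hE
  rw [← generateFrom_prod] at hE
  induction E, hE using MeasurableSpace.generateFrom_induction with
  | hC t ht _ =>
    obtain ⟨a, ha, b, hb, rfl⟩ := ht
    refine ⟨Bool, inferInstance, inferInstance, fun ω => decide (ω ∈ b), a ×ˢ {true},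
      measurable_to_bool ?_, MeasurableSet.prod ha (measurableSet_singleton _), ?_⟩
    · convert! hb using 1
      ext; simp
    · ext; simp
  | empty =>
    exact ⟨Unit, inferInstance, inferInstance, fun _ => (), ∅, measurable_const,
      MeasurableSet.empty, by simp⟩
  | compl t ht ih =>
    obtain ⟨W, _, _, φ, E', hφ, hE', rfl⟩ := ih (by rwa [MeasurableSet.compl_iff] at hE0)
    exact ⟨W, inferInstance, inferInstance, φ, E'ᶜ, hφ, hE'.compl, rfl⟩
  | iUnion s hs ih =>
    choose W hW hW' φ E' hφ hE' hs' using fun k => ih k (by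
      have := hs k; rwa [generateFrom_prod] at this)
    refine ⟨∀ k, W k, inferInstance, inferInstance, fun ω k => φ k ω,
      ⋃ k, Prod.map id (fun w => w k) ⁻¹' E' k, measurable_pi_lambda _ hφ,
      MeasurableSet.iUnion fun k =>
        (measurable_id.prodMap (measurable_pi_apply k)) (hE' k), ?_⟩
    ext p
    simp only [Set.mem_iUnion, Set.mem_preimage]
    refine exists_congr fun k => ?_
    conv_lhs => rw [hs' k]
    rfl

/-- The measurable projection theorem: the projection of a measurable set along a standard Borel
factor is universally measurable. -/
theorem MeasurableSet.nullMeasurableSet_exists {S Ω : Type*} [MeasurableSpace S]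
    [StandardBorelSpace S] [MeasurableSpace Ω] {E : Set (S × Ω)} (hE : MeasurableSet E)
    (μ : Measure Ω) [IsFiniteMeasure μ] : NullMeasurableSet {ω | ∃ s, (s, ω) ∈ E} μ := by
  obtain ⟨W, _, _, φ, E', hφ, hE', rfl⟩ := exists_standardBorel_preimage_eq hE
  let := upgradeStandardBorel W
  have h := (hE'.analyticSet_image measurable_snd).nullMeasurableSet (μ.map φ)
  convert! h.preimage ⟨hφ, Measure.AbsolutelyContinuous.rfl⟩ using 1
  ext ω
  simp

/-- The supremum of a bounded family of measurable functions with a standard Borel parameter is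
almost everywhere measurable. -/
theorem aemeasurable_iSup_of_standardBorel {S Ω : Type*} [MeasurableSpace S]
    [StandardBorelSpace S] [Nonempty S] [MeasurableSpace Ω] (μ : Measure Ω) [IsFiniteMeasure μ]
    {F : S → Ω → ℝ} (hF : Measurable fun p : S × Ω => F p.1 p.2)
    (hb : ∀ ω, BddAbove (Set.range fun s => F s ω)) :
    AEMeasurable (fun ω => ⨆ s, F s ω) μ := by
  refine NullMeasurable.aemeasurable ?_
  rw [nullMeasurable_iff_eventuallyMeasurable]
  refine @measurable_of_Ioi _ _ _ _ _ (_) _ _ _ _ fun c => ?_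
  have h := (hF (measurableSet_Ioi (a := c))).nullMeasurableSet_exists μ
  have hEq : (fun ω => ⨆ s, F s ω) ⁻¹' Set.Ioi c = {ω | ∃ s, (s, ω) ∈
      (fun p : S × Ω => F p.1 p.2) ⁻¹' Set.Ioi c} := by
    ext ω
    simp [lt_ciSup_iff (hb ω)]
  rw [hEq]
  exact h

theorem aemeasurable_iInf_of_standardBorel {S Ω : Type*} [MeasurableSpace S]
    [StandardBorelSpace S] [Nonempty S] [MeasurableSpace Ω] (μ : Measure Ω) [IsFiniteMeasure μ]
    {F : S → Ω → ℝ} (hF : Measurable fun p : S × Ω => F p.1 p.2)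
    (hb : ∀ ω, BddBelow (Set.range fun s => F s ω)) :
    AEMeasurable (fun ω => ⨅ s, F s ω) μ := by
  have h := (aemeasurable_iSup_of_standardBorel μ (F := fun s ω => -F s ω) hF.neg
    fun ω => ?_).neg
  · refine h.congr (Filter.Eventually.of_forall fun ω => ?_)
    change _ = sInf (Set.range fun s => F s ω)
    rw [Real.sInf_def, ← Set.image_neg_eq_neg, ← Set.range_comp]
    rfl
  · have := (hb ω).neg
    rwa [← Set.image_neg_eq_neg, ← Set.range_comp] at this

/-! ### Symmetrization -/

/-- Hoeffding's inequality for random signs, in counting form. -/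
theorem card_signs_sum_ge_le {ι : Type*} [Fintype ι] [DecidableEq ι] [Nonempty ι] (d : ι → ℝ)
    (hd : ∀ i, |d i| ≤ 1) {t : ℝ} (ht : 0 ≤ t) :
    ((Finset.univ.filter fun σ : ι → Bool => t ≤ ∑ i, if σ i then d i else -d i).card : ℝ) ≤
      2 ^ Fintype.card ι * Real.exp (-t ^ 2 / (2 * Fintype.card ι)) := by
  set k : ℝ := (Fintype.card ι : ℝ) with hk
  have hk0 : 0 < k := by rw [hk]; exact_mod_cast Fintype.card_pos
  -- the parameter that optimizes the exponential Markov inequality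
  set l : ℝ := t / k with hl
  have hl0 : 0 ≤ l := by positivity
  have h1 : ((Finset.univ.filter fun σ : ι → Bool =>
      t ≤ ∑ i, if σ i then d i else -d i).card : ℝ) * Real.exp (l * t) ≤
      ∑ σ : ι → Bool, ∏ i, Real.exp (l * if σ i then d i else -d i) := by
    rw [← nsmul_eq_mul, ← Finset.sum_const]
    calc _ ≤ ∑ σ ∈ Finset.univ.filter (fun σ : ι → Bool =>
          t ≤ ∑ i, if σ i then d i else -d i), ∏ i, Real.exp (l * if σ i then d i else -d i) := by
          refine Finset.sum_le_sum fun σ hσ => ?_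
          rw [← Real.exp_sum, ← Finset.mul_sum]
          exact Real.exp_le_exp.2 (mul_le_mul_of_nonneg_left (Finset.mem_filter.1 hσ).2 hl0)
      _ ≤ _ := Finset.sum_le_sum_of_subset_of_nonneg (Finset.filter_subset _ _)
          fun σ _ _ => Finset.prod_nonneg fun i _ => (Real.exp_pos _).le
  have h2 : ∑ σ : ι → Bool, ∏ i, Real.exp (l * if σ i then d i else -d i) ≤
      2 ^ Fintype.card ι * Real.exp (k * (l ^ 2 / 2)) := by
    have h := Finset.prod_univ_sum (fun _ => (Finset.univ : Finset Bool))
      (fun i b => Real.exp (l * if b then d i else -d i))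
    rw [Fintype.piFinset_univ] at h
    rw [← h]
    rw [show k * (l ^ 2 / 2) = (Fintype.card ι : ℕ) * (l ^ 2 / 2) from rfl, Real.exp_nat_mul,
      ← mul_pow, ← Finset.card_univ, ← Finset.prod_const]
    refine Finset.prod_le_prod (fun i _ => Finset.sum_nonneg fun b _ => (Real.exp_pos _).le)
      fun i _ => ?_
    have h3 : ∑ b : Bool, Real.exp (l * if b then d i else -d i) = 2 * Real.cosh (l * d i) := by
      rw [Real.cosh_eq]; simp; ring
    rw [h3]
    refine mul_le_mul_of_nonneg_left ((Real.cosh_le_exp_half_sq _).trans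
      (Real.exp_le_exp.2 ?_)) (by norm_num)
    have : d i ^ 2 ≤ 1 := by rw [← sq_abs]; exact pow_le_one₀ (abs_nonneg _) (hd i)
    rw [mul_pow]
    nlinarith [sq_nonneg l]
  have h4 := h1.trans h2
  rw [← le_div_iff₀ (Real.exp_pos _), mul_div_assoc, ← Real.exp_sub] at h4
  refine h4.trans_eq ?_
  congr 2
  rw [hl]
  field_simp
  ring

section Symmetrization

variable {ι Z Θ : Type*} [Fintype ι]

/-- Chebyshev's inequality for the lower tail of a sum of independent `[0, 1]`-valued variables. -/
theorem measure_pi_sum_lt_le_half [MeasurableSpace Z] (μ : ι → Measure Z)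
    [∀ i, IsProbabilityMeasure (μ i)]
    {g : ι → Z → ℝ} (hg : ∀ i, Measurable (g i)) (hg01 : ∀ i z, g i z ∈ Set.Icc (0 : ℝ) 1)
    {b : ℝ} (hb : 0 < b) (hcard : (Fintype.card ι : ℝ) ≤ 2 * b ^ 2) :
    Measure.pi μ {z | ∑ i, g i (z i) < ∑ i, ∫ x, g i x ∂(μ i) - b} ≤ 1 / 2 := by
  have hL : ∀ i, MemLp (g i) 2 (μ i) := fun i =>
    MemLp.of_bound (hg i).aestronglyMeasurable 1 (Filter.Eventually.of_forall fun z => by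
      rw [Real.norm_eq_abs, abs_of_nonneg (hg01 i z).1]; exact (hg01 i z).2)
  have hint : ∀ i, Integrable (fun z : ι → Z => g i (z i)) (Measure.pi μ) := fun i =>
    (measurePreserving_eval μ i).integrable_comp_of_integrable ((hL i).integrable (by norm_num))
  have hmean : ∫ z, (∑ i, fun z : ι → Z => g i (z i)) z ∂(Measure.pi μ) =
      ∑ i, ∫ x, g i x ∂(μ i) := by
    simp only [Finset.sum_apply]
    rw [integral_finsetSum _ fun i _ => hint i]
    refine Finset.sum_congr rfl fun i _ => ?_
    have h := integral_map (μ := Measure.pi μ) (φ := Function.eval i)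
      (measurable_pi_apply i).aemeasurable (f := g i)
      (by rw [(measurePreserving_eval μ i).map_eq]; exact (hg i).aestronglyMeasurable)
    rw [(measurePreserving_eval μ i).map_eq] at h
    exact h.symm
  have hmem : MemLp (∑ i, fun z : ι → Z => g i (z i)) 2 (Measure.pi μ) :=
    memLp_finsetSum' _ fun i _ =>
      (hL i).comp_measurePreserving (measurePreserving_eval μ i)
  have hvar : ProbabilityTheory.variance (∑ i, fun z : ι → Z => g i (z i)) (Measure.pi μ) ≤
      Fintype.card ι / 4 := by
    rw [ProbabilityTheory.variance_sum_pi hL]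
    calc _ ≤ ∑ i : ι, ((1 - 0 : ℝ) / 2) ^ 2 := Finset.sum_le_sum fun i _ =>
          ProbabilityTheory.variance_le_sq_of_bounded (Filter.Eventually.of_forall (hg01 i))
            (hg i).aemeasurable
      _ = _ := by simp; ring
  refine (measure_mono ?_).trans
    ((ProbabilityTheory.meas_ge_le_variance_div_sq hmem hb).trans ?_)
  · intro z hz
    simp only [Set.mem_ofPred_eq] at hz ⊢
    rw [hmean, Finset.sum_apply, abs_sub_comm]
    exact le_trans (by linarith) (le_abs_self _)
  · rw [show (1 / 2 : ENNReal) = ENNReal.ofReal (1 / 2) by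
      rw [ENNReal.ofReal_div_of_pos (by norm_num)]; simp]
    refine ENNReal.ofReal_le_ofReal ?_
    rw [div_le_iff₀ (by positivity)]
    linarith

/-- Symmetrization by a ghost sample, for outer measures: no measurability in the parameter is
needed, because the sections of a measurable hull of the two-sample event are large enough. -/
theorem measure_pi_exists_le_two_mul_prod [MeasurableSpace Z] (μ : ι → Measure Z)
    [∀ i, IsProbabilityMeasure (μ i)]
    {g : Θ → ι → Z → ℝ} (hg : ∀ θ i, Measurable (g θ i))
    (hg01 : ∀ θ i z, g θ i z ∈ Set.Icc (0 : ℝ) 1)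
    {b : ℝ} (hb : 0 < b) (hcard : (Fintype.card ι : ℝ) ≤ 2 * b ^ 2) :
    Measure.pi μ {z | ∃ θ, 2 * b < ∑ i, ∫ x, g θ i x ∂(μ i) - ∑ i, g θ i (z i)} ≤
      2 * ((Measure.pi μ).prod (Measure.pi μ))
        {p | ∃ θ, b < ∑ i, (g θ i (p.2 i) - g θ i (p.1 i))} := by
  set D := {p : (ι → Z) × (ι → Z) | ∃ θ, b < ∑ i, (g θ i (p.2 i) - g θ i (p.1 i))}
  set B := toMeasurable ((Measure.pi μ).prod (Measure.pi μ)) D with hB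
  have hBm : MeasurableSet B := measurableSet_toMeasurable _ _
  have hsub : {z | ∃ θ, 2 * b < ∑ i, ∫ x, g θ i x ∂(μ i) - ∑ i, g θ i (z i)} ⊆
      {z | 1 / 2 ≤ Measure.pi μ (Prod.mk z ⁻¹' B)} := by
    rintro z ⟨θ, hθ⟩
    have h1 := measure_pi_sum_lt_le_half μ (hg θ) (hg01 θ) hb hcard
    have hm : MeasurableSet {z : ι → Z | ∑ i, g θ i (z i) < ∑ i, ∫ x, g θ i x ∂(μ i) - b} :=
      measurableSet_lt (Finset.measurable_sum _ fun i _ =>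
        (hg θ i).comp (measurable_pi_apply i)) measurable_const
    have h2 : {z : ι → Z | ∑ i, g θ i (z i) < ∑ i, ∫ x, g θ i x ∂(μ i) - b}ᶜ ⊆
        Prod.mk z ⁻¹' B := by
      intro z' hz'
      refine subset_toMeasurable _ _ ⟨θ, ?_⟩
      simp only [Set.mem_compl_iff, Set.mem_ofPred_eq, not_lt] at hz'
      rw [Finset.sum_sub_distrib]
      linarith
    refine le_trans ?_ (measure_mono h2)
    rw [prob_compl_eq_one_sub hm]
    refine le_trans ?_ (tsub_le_tsub_left h1 1)
    simp
  calc _ ≤ Measure.pi μ {z | 1 / 2 ≤ Measure.pi μ (Prod.mk z ⁻¹' B)} := measure_mono hsub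
    _ = 2 * ((1 / 2) * Measure.pi μ {z | 1 / 2 ≤ Measure.pi μ (Prod.mk z ⁻¹' B)}) := by
      rw [← mul_assoc, one_div, ENNReal.mul_inv_cancel (by simp) (by simp), one_mul]
    _ ≤ 2 * ∫⁻ z, Measure.pi μ (Prod.mk z ⁻¹' B) ∂(Measure.pi μ) := by
      gcongr
      exact mul_meas_ge_le_lintegral (measurable_measure_prodMk_left hBm) _
    _ = 2 * ((Measure.pi μ).prod (Measure.pi μ)) D := by
      rw [← Measure.prod_apply hBm, hB, measure_toMeasurable]

/-- The double sample with the pairs swapped in the coordinates `i` where `σ i` is `false`. -/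
def swapSample (σ : ι → Bool) (w : ι → Z × Z) : ι → Z × Z :=
  fun i => (if σ i then id else Prod.swap) (w i)

theorem measurePreserving_swapSample [MeasurableSpace Z] (μ : ι → Measure Z)
    [∀ i, IsProbabilityMeasure (μ i)]
    (σ : ι → Bool) :
    MeasurePreserving (swapSample σ) (Measure.pi fun i => (μ i).prod (μ i))
      (Measure.pi fun i => (μ i).prod (μ i)) := by
  refine measurePreserving_pi (f := fun i => if σ i then id else Prod.swap) _ _ fun i => ?_
  split_ifs
  · exact MeasurePreserving.id _
  · exact Measure.measurePreserving_swap

/-- For a fixed double sample, few of the swaps lead to a large deviation between its two halves: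
Hoeffding's inequality for the members of a cover and the union bound. -/
theorem card_swapSample_exists_le [DecidableEq ι] [Nonempty ι] {g : Θ → ι → Z → ℝ}
    (hg01 : ∀ θ i z, g θ i z ∈ Set.Icc (0 : ℝ) 1) {b u : ℝ} (hu : u ≤ b) (w : ι → Z × Z)
    (C : Finset Θ) (hC : ∀ θ, ∃ c ∈ C,
      ∑ i, (|g θ i (w i).1 - g c i (w i).1| + |g θ i (w i).2 - g c i (w i).2|) ≤ u)
    [DecidablePred fun σ : ι → Bool => ∃ θ, b < ∑ i,
      (g θ i (swapSample σ w i).2 - g θ i (swapSample σ w i).1)] :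
    ((Finset.univ.filter fun σ : ι → Bool => ∃ θ, b < ∑ i,
      (g θ i (swapSample σ w i).2 - g θ i (swapSample σ w i).1)).card : ℝ) ≤
      C.card * (2 ^ Fintype.card ι * Real.exp (-(b - u) ^ 2 / (2 * Fintype.card ι))) := by
  classical
  have hterm : ∀ θ (σ : ι → Bool) i,
      g θ i (swapSample σ w i).2 - g θ i (swapSample σ w i).1 =
        if σ i then g θ i (w i).2 - g θ i (w i).1 else -(g θ i (w i).2 - g θ i (w i).1) := by
    intro θ σ i
    unfold swapSample
    split_ifs <;> simp
  have hsub : (Finset.univ.filter fun σ : ι → Bool => ∃ θ, b < ∑ i,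
      (g θ i (swapSample σ w i).2 - g θ i (swapSample σ w i).1)) ⊆
      C.biUnion fun c => Finset.univ.filter fun σ : ι → Bool => b - u ≤ ∑ i,
        if σ i then g c i (w i).2 - g c i (w i).1 else -(g c i (w i).2 - g c i (w i).1) := by
    intro σ hσ
    obtain ⟨θ, hθ⟩ := (Finset.mem_filter.1 hσ).2
    obtain ⟨c, hc, hcu⟩ := hC θ
    refine Finset.mem_biUnion.2 ⟨c, hc, Finset.mem_filter.2 ⟨Finset.mem_univ _, ?_⟩⟩
    simp only [hterm] at hθ
    have h : ∑ i, (if σ i then g θ i (w i).2 - g θ i (w i).1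
          else -(g θ i (w i).2 - g θ i (w i).1)) -
        ∑ i, (if σ i then g c i (w i).2 - g c i (w i).1
          else -(g c i (w i).2 - g c i (w i).1)) ≤ u := by
      rw [← Finset.sum_sub_distrib]
      refine (Finset.sum_le_sum fun i _ => ?_).trans hcu
      have h1 := abs_le.1 (le_refl |g θ i (w i).1 - g c i (w i).1|)
      have h2 := abs_le.1 (le_refl |g θ i (w i).2 - g c i (w i).2|)
      split_ifs <;> linarith [h1.1, h1.2, h2.1, h2.2]
    linarith
  calc _ ≤ ((C.biUnion fun c => Finset.univ.filter fun σ : ι → Bool => b - u ≤ ∑ i,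
        if σ i then g c i (w i).2 - g c i (w i).1
          else -(g c i (w i).2 - g c i (w i).1)).card : ℝ) := by
        exact_mod_cast Finset.card_le_card hsub
    _ ≤ ∑ c ∈ C, ((Finset.univ.filter fun σ : ι → Bool => b - u ≤ ∑ i,
        if σ i then g c i (w i).2 - g c i (w i).1
          else -(g c i (w i).2 - g c i (w i).1)).card : ℝ) := by
        exact_mod_cast Finset.card_biUnion_le
    _ ≤ ∑ c ∈ C, (2 ^ Fintype.card ι *
        Real.exp (-(b - u) ^ 2 / (2 * Fintype.card ι))) := by
        refine Finset.sum_le_sum fun c _ => card_signs_sum_ge_le _ (fun i => ?_) (by linarith)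
        have h1 := hg01 c i (w i).1
        have h2 := hg01 c i (w i).2
        exact abs_le.2 ⟨by linarith [h1.1, h1.2, h2.1, h2.2],
          by linarith [h1.1, h1.2, h2.1, h2.2]⟩
    _ = _ := by simp

/-- Uniform one-sided deviation bound for a class of `[0, 1]`-valued functions with a standard
Borel parameter, in terms of the sizes of the empirical `L¹` covers on double samples. -/
theorem measure_pi_exists_deviation_le [MeasurableSpace Z] [Nonempty ι]
    [MeasurableSpace Θ] [StandardBorelSpace Θ]
    (μ : ι → Measure Z) [∀ i, IsProbabilityMeasure (μ i)]
    {g : Θ → ι → Z → ℝ} (hg : ∀ i, Measurable fun p : Θ × Z => g p.1 i p.2)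
    (hg01 : ∀ θ i z, g θ i z ∈ Set.Icc (0 : ℝ) 1)
    {b u : ℝ} (hb : 0 < b) (hu : u ≤ b) (hcard : (Fintype.card ι : ℝ) ≤ 2 * b ^ 2) (N : ℕ)
    (hN : ∀ w : ι → Z × Z, ∃ C : Finset Θ, C.card ≤ N ∧ ∀ θ, ∃ c ∈ C,
      ∑ i, (|g θ i (w i).1 - g c i (w i).1| + |g θ i (w i).2 - g c i (w i).2|) ≤ u) :
    Measure.pi μ {z | ∃ θ, 2 * b < ∑ i, ∫ x, g θ i x ∂(μ i) - ∑ i, g θ i (z i)} ≤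
      ENNReal.ofReal (2 * (N * Real.exp (-(b - u) ^ 2 / (2 * Fintype.card ι)))) := by
  classical
  have hgθ : ∀ θ i, Measurable (g θ i) := fun θ i => (hg i).comp measurable_prodMk_left
  refine (measure_pi_exists_le_two_mul_prod μ hgθ hg01 hb hcard).trans ?_
  rw [ENNReal.ofReal_mul (by norm_num), ENNReal.ofReal_ofNat]
  gcongr
  set ν := Measure.pi fun i => (μ i).prod (μ i) with hν
  set D : Set (ι → Z × Z) := {w | ∃ θ, b < ∑ i, (g θ i (w i).2 - g θ i (w i).1)} with hD
  have hprod : ((Measure.pi μ).prod (Measure.pi μ))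
      {p | ∃ θ, b < ∑ i, (g θ i (p.2 i) - g θ i (p.1 i))} = ν D := by
    rw [← (measurePreserving_arrowProdEquivProdArrow Z Z ι μ μ).map_eq,
      MeasurableEquiv.map_apply]
    rfl
  have hDm : NullMeasurableSet D ν := by
    refine MeasurableSet.nullMeasurableSet_exists (E := {p : Θ × (ι → Z × Z) |
      b < ∑ i, (g p.1 i (p.2 i).2 - g p.1 i (p.2 i).1)}) ?_ ν
    refine measurableSet_lt measurable_const (Finset.measurable_sum _ fun i _ => ?_)
    exact ((hg i).comp (measurable_fst.prodMk
        ((measurable_pi_apply i).comp measurable_snd).snd)).sub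
      ((hg i).comp (measurable_fst.prodMk
        ((measurable_pi_apply i).comp measurable_snd).fst))
  have hmp := measurePreserving_swapSample μ
  -- `ν D` is the average over `σ` of the probability that the swapped sample lies in `D`; this
  -- needs `D` to be null measurable
  have hσ : ∀ σ : ι → Bool, ν D = ∫⁻ w, (swapSample σ ⁻¹' D).indicator 1 w ∂ν := by
    intro σ
    rw [lintegral_indicator_one₀ (hDm.preimage (hmp σ).quasiMeasurePreserving),
      (hmp σ).measure_preimage hDm]
  have hsum : (2 : ENNReal) ^ Fintype.card ι * ν D =
      ∫⁻ w, ∑ σ : ι → Bool, (swapSample σ ⁻¹' D).indicator 1 w ∂ν := by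
    rw [lintegral_finsetSum' _ fun σ _ => ?_]
    · rw [← Finset.sum_congr rfl fun σ _ => hσ σ]
      simp
    · exact (aemeasurable_indicator_const_iff 1).2
        (hDm.preimage (hmp σ).quasiMeasurePreserving)
  have hbound : ∀ w, ∑ σ : ι → Bool, (swapSample σ ⁻¹' D).indicator (1 : (ι → Z × Z) → ENNReal) w ≤
      ENNReal.ofReal (2 ^ Fintype.card ι *
        (N * Real.exp (-(b - u) ^ 2 / (2 * Fintype.card ι)))) := by
    intro w
    obtain ⟨C, hCN, hC⟩ := hN w
    have h := card_swapSample_exists_le hg01 hu w C hC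
    have hcount : ∑ σ : ι → Bool, (swapSample σ ⁻¹' D).indicator (1 : (ι → Z × Z) → ENNReal) w =
        ((Finset.univ.filter fun σ : ι → Bool => ∃ θ, b < ∑ i,
          (g θ i (swapSample σ w i).2 - g θ i (swapSample σ w i).1)).card : ENNReal) := by
      rw [Finset.card_filter]
      push_cast
      refine Finset.sum_congr rfl fun σ _ => ?_
      simp [Set.indicator_apply, hD]
    rw [hcount, ← ENNReal.ofReal_natCast]
    refine ENNReal.ofReal_le_ofReal (h.trans ?_)
    rw [mul_left_comm]
    gcongr
  have hfin : (2 : ENNReal) ^ Fintype.card ι * ν D ≤ 2 ^ Fintype.card ι *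
      ENNReal.ofReal (N * Real.exp (-(b - u) ^ 2 / (2 * Fintype.card ι))) := by
    rw [hsum]
    refine (lintegral_mono hbound).trans ?_
    rw [lintegral_const, measure_univ, mul_one, ENNReal.ofReal_mul (by positivity),
      ENNReal.ofReal_pow (by norm_num), ENNReal.ofReal_ofNat]
  rw [hprod]
  exact (ENNReal.mul_le_mul_iff_right (by simp) (by finiteness)).1 hfin

/-- The sample size that a deviation of `ε / 2` in the averages and confidence `δ / 2` require. -/
theorem measure_pi_exists_half_eps_deviation_le [MeasurableSpace Z]
    [MeasurableSpace Θ] [StandardBorelSpace Θ]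
    (μ : ι → Measure Z) [∀ i, IsProbabilityMeasure (μ i)]
    {g : Θ → ι → Z → ℝ} (hg : ∀ i, Measurable fun p : Θ × Z => g p.1 i p.2)
    (hg01 : ∀ θ i z, g θ i z ∈ Set.Icc (0 : ℝ) 1)
    {ε δ : ℝ} (hε : 0 < ε) (hδ : 0 < δ) (N : ℕ)
    (hk : 64 / ε ^ 2 ≤ (Fintype.card ι : ℝ))
    (hkN : 256 / ε ^ 2 * Real.log (8 * N / δ) ≤ (Fintype.card ι : ℝ))
    (hN : ∀ w : ι → Z × Z, ∃ C : Finset Θ, C.card ≤ N ∧ ∀ θ, ∃ c ∈ C,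
      ∑ i, (|g θ i (w i).1 - g c i (w i).1| + |g θ i (w i).2 - g c i (w i).2|) ≤
        Fintype.card ι * (ε / 16)) :
    Measure.pi μ {z | ∃ θ, Fintype.card ι * (ε / 2) <
      ∑ i, ∫ x, g θ i x ∂(μ i) - ∑ i, g θ i (z i)} ≤ ENNReal.ofReal (δ / 2) := by
  set k : ℝ := (Fintype.card ι : ℝ) with hkdef
  have hk0 : 0 < k := lt_of_lt_of_le (by positivity) hk
  have : Nonempty ι := Fintype.card_pos_iff.1 (Nat.cast_pos.1 hk0)
  have hkε : 64 ≤ k * ε ^ 2 := (div_le_iff₀ (by positivity)).1 hk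
  -- the ghost sample halves the deviation `k * (ε / 2)`, and the passage to the cover costs
  -- another `k * (ε / 16)`
  have h := measure_pi_exists_deviation_le μ hg hg01 (b := k * (ε / 4)) (u := k * (ε / 16))
    (by positivity) (by nlinarith) (by nlinarith [mul_pos hk0 hε]) N hN
  rw [show 2 * (k * (ε / 4)) = k * (ε / 2) by ring] at h
  refine h.trans (ENNReal.ofReal_le_ofReal ?_)
  have hexp : -(k * (ε / 4) - k * (ε / 16)) ^ 2 / (2 * k) = -(9 * (k * ε ^ 2) / 512) := by
    field_simp
    ring
  rw [hexp]
  rcases Nat.eq_zero_or_pos N with rfl | hN0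
  · simp; positivity
  have hN1 : (0 : ℝ) < N := by exact_mod_cast hN0
  have h1 : Real.log (8 * N / δ) ≤ k * ε ^ 2 / 256 := by
    rw [div_mul_eq_mul_div, div_le_iff₀ (by positivity)] at hkN
    linarith
  have h2 : 8 * N / δ ≤ Real.exp (k * ε ^ 2 / 256) :=
    (Real.log_le_iff_le_exp (by positivity)).1 h1
  have h3 : Real.exp (-(9 * (k * ε ^ 2) / 512)) ≤ (Real.exp (k * ε ^ 2 / 256))⁻¹ := by
    rw [← Real.exp_neg]
    exact Real.exp_le_exp.2 (by linarith)
  have h4 : (Real.exp (k * ε ^ 2 / 256))⁻¹ ≤ (8 * N / δ)⁻¹ := inv_anti₀ (by positivity) h2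
  calc 2 * (N * Real.exp (-(9 * (k * ε ^ 2) / 512))) ≤ 2 * (N * (8 * N / δ)⁻¹) := by
        gcongr; exact h3.trans h4
    _ = δ / 4 := by field_simp; norm_num
    _ ≤ δ / 2 := by linarith

end Symmetrization

/-! ### Mixtures, empirical distributions and separable infima -/

/-- The measure of the section of a measurable set is measurable in the parameter. -/
theorem measurable_real_section {α β : Type*} [MeasurableSpace α] [MeasurableSpace β]
    {κ : α → Measure β} (hκ : Measurable κ) [∀ a, IsProbabilityMeasure (κ a)]
    {t : Set (α × β)} (ht : MeasurableSet t) :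
    Measurable fun a => (κ a).real {b | (a, b) ∈ t} := by
  let K : ProbabilityTheory.Kernel α β := ⟨κ, hκ⟩
  have : ProbabilityTheory.IsMarkovKernel K := ⟨fun a => inferInstanceAs
    (IsProbabilityMeasure (κ a))⟩
  exact (ProbabilityTheory.Kernel.measurable_kernel_prodMk_left (κ := K) ht).ennreal_toReal

theorem measurable_measure_pi {ι α β : Type*} [Fintype ι] [MeasurableSpace α]
    [MeasurableSpace β] {κ : ι → α → Measure β} (hκ : ∀ i, Measurable (κ i))
    [∀ i a, IsProbabilityMeasure (κ i a)] :
    Measurable fun a => Measure.pi fun i => κ i a := by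
  refine Measurable.measure_of_isPiSystem_of_isProbabilityMeasure generateFrom_pi.symm
    isPiSystem_pi ?_
  rintro _ ⟨s, hs, rfl⟩
  simp only [Measure.pi_pi]
  exact Finset.measurable_prod _ fun i _ =>
    (Measure.measurable_coe (hs i (Set.mem_univ i))).comp (hκ i)

/-- A product of mixtures is a mixture of products. -/
theorem pi_bind_eq_bind_pi {ι α β : Type*} [Fintype ι] [MeasurableSpace α]
    [MeasurableSpace β] (Q : Measure α) [IsProbabilityMeasure Q] {κ : α → Measure β}
    (hκ : Measurable κ) [∀ a, IsProbabilityMeasure (κ a)] :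
    (Measure.pi fun _ : ι => Q.bind κ) =
      (Measure.pi fun _ : ι => Q).bind fun P => Measure.pi fun i => κ (P i) := by
  have : IsProbabilityMeasure (Q.bind κ) :=
    isProbabilityMeasure_bind hκ.aemeasurable (Filter.Eventually.of_forall inferInstance)
  refine Measure.pi_eq fun s hs => ?_
  have hm : ∀ i : ι, Measurable fun a => κ a (s i) := fun i =>
    (Measure.measurable_coe (hs i)).comp hκ
  rw [Measure.bind_apply (MeasurableSet.univ_pi hs) (measurable_measure_pi
    (κ := fun i (P : ι → α) => κ (P i))
    fun i => hκ.comp (measurable_pi_apply i)).aemeasurable]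
  simp only [Measure.pi_pi]
  rw [ProbabilityTheory.lintegral_prod_eq_prod_lintegral_of_indepFun Finset.univ
    (fun i (P : ι → α) => κ (P i) (s i))
    (ProbabilityTheory.iIndepFun_pi (X := fun i a => κ a (s i)) fun i => (hm i).aemeasurable)
    fun i => (hm i).comp (measurable_pi_apply i)]
  refine Finset.prod_congr rfl fun i _ => ?_
  rw [Measure.bind_apply (hs i) hκ.aemeasurable]
  exact (measurePreserving_eval (fun _ : ι => Q) i).lintegral_comp (hm i)

/-- The union bound for a mixture: an event that is unlikely unless the mixture parameter lies in
an unlikely set is unlikely. -/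
theorem bind_apply_le_add {α β : Type*} [MeasurableSpace α] [MeasurableSpace β] (μ : Measure α)
    [IsProbabilityMeasure μ] {κ : α → Measure β} (hκ : Measurable κ)
    [∀ a, IsProbabilityMeasure (κ a)] {s : Set β} (hs : NullMeasurableSet s (μ.bind κ))
    {A : Set α} {a b : ENNReal} (ha : μ A ≤ a) (hb : ∀ x ∉ A, κ x s ≤ b) :
    μ.bind κ s ≤ a + b := by
  obtain ⟨t, hts, ht, hts'⟩ := hs.exists_measurable_subset_ae_eq
  rw [← measure_congr hts', Measure.bind_apply ht hκ.aemeasurable]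
  calc ∫⁻ x, κ x t ∂μ ≤ ∫⁻ x, ((toMeasurable μ A).indicator 1 x + b) ∂μ := by
        refine lintegral_mono fun x => ?_
        by_cases hx : x ∈ A
        · have hx' := subset_toMeasurable μ A hx
          simp only [Set.indicator_of_mem hx', Pi.one_apply]
          exact prob_le_one.trans le_self_add
        · exact ((measure_mono hts).trans (hb x hx)).trans le_add_self
    _ = μ A + b := by
        rw [lintegral_add_right _ measurable_const,
          lintegral_indicator_one (measurableSet_toMeasurable _ _), measure_toMeasurable]
        simp
    _ ≤ a + b := by gcongr

/-- The uniform distribution on the points of a double sample. -/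
theorem exists_empirical_probabilityMeasure {κ Z : Type*} [Fintype κ] [Nonempty κ]
    [MeasurableSpace Z] (w : κ → Z × Z) :
    ∃ P : ProbabilityMeasure Z, ∀ F : Z → ℝ, Measurable F →
      ∫ z, F z ∂(P : Measure Z) =
        (1 / (2 * Fintype.card κ : ℝ)) * ∑ k, (F (w k).1 + F (w k).2) := by
  let μ : Measure Z := (2 * Fintype.card κ : ENNReal)⁻¹ •
    ∑ k, (Measure.dirac (w k).1 + Measure.dirac (w k).2)
  have hμ : IsProbabilityMeasure μ := ⟨by
    simp only [μ, Measure.smul_apply, Measure.coe_finsetSum, Finset.sum_apply,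
      Measure.add_apply, measure_univ, Finset.sum_const, Finset.card_univ, smul_eq_mul,
      nsmul_eq_mul, one_add_one_eq_two]
    rw [mul_comm (2 : ENNReal)]
    exact ENNReal.inv_mul_cancel (by simp) (by finiteness)⟩
  refine ⟨⟨μ, hμ⟩, fun F hF => ?_⟩
  have hd : ∀ z, Integrable F (Measure.dirac z) := fun z =>
    integrable_dirac' hF.stronglyMeasurable (by finiteness)
  change ∫ z, F z ∂μ = _
  rw [integral_smul_measure, integral_finsetSum_measure fun k _ => (hd _).add_measure (hd _)]
  simp only [integral_add_measure (hd _) (hd _), integral_dirac' F _ hF.stronglyMeasurable]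
  simp

theorem pi_pi_apply_eq_pi_prod {ι κ Z : Type*} [Fintype ι] [Fintype κ] [MeasurableSpace Z]
    (μ : ι → Measure Z) [∀ i, IsProbabilityMeasure (μ i)] (s : Set (ι → κ → Z)) :
    (Measure.pi fun i => Measure.pi fun _ : κ => μ i) s =
      (Measure.pi fun p : ι × κ => μ p.1) {z | (fun i j => z (i, j)) ∈ s} := by
  have h := Measure.infinitePi_map_curry (fun (i : ι) (_ : κ) => μ i)
  simp only [Measure.infinitePi_eq_pi] at h
  rw [← h, MeasurableEquiv.map_apply]
  rfl

theorem integral_le_add_of_ae_le {α : Type*} [MeasurableSpace α] {μ : Measure α}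
    [IsProbabilityMeasure μ] {φ a b c : α → ℝ} {η : ℝ} (hφ : Integrable φ μ)
    (ha : Integrable a μ) (hb : Integrable b μ) (hc : Integrable c μ)
    (h : ∀ᵐ x ∂μ, φ x ≤ a x + η + 1 / 2 * b x + c x) :
    ∫ x, φ x ∂μ ≤ ∫ x, a x ∂μ + η + 1 / 2 * ∫ x, b x ∂μ + ∫ x, c x ∂μ := by
  have h1 : Integrable (fun x => a x + η) μ := ha.add (integrable_const η)
  have h2 : Integrable (fun x => 1 / 2 * b x) μ := hb.const_mul _
  have h3 : Integrable (fun x => a x + η + 1 / 2 * b x) μ := h1.add h2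
  refine (integral_mono_ae hφ (h3.add hc) h).trans_eq ?_
  change ∫ x, (a x + η + 1 / 2 * b x + c x) ∂μ = _
  rw [integral_add h3 hc, integral_add h1 h2, integral_add ha (integrable_const η),
    integral_const_mul]
  simp

/-- A separable infimum can be undercut by choosing the minimizers independently. -/
theorem sum_iInf_lt_iff {ι T : Type*} [Fintype ι] [Nonempty T] {F : ι → T → ℝ}
    (hF : ∀ i, BddBelow (Set.range (F i))) {c : ℝ} :
    ∑ i, ⨅ t, F i t < c ↔ ∃ t : ι → T, ∑ i, F i (t i) < c := by
  constructor
  · intro h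
    rcases isEmpty_or_nonempty ι with hι | hι
    · exact ⟨fun i => isEmptyElim i, by simpa using h⟩
    set e := (c - ∑ i, ⨅ t, F i t) / Fintype.card ι with he
    have hk : (0 : ℝ) < Fintype.card ι := by exact_mod_cast Fintype.card_pos
    have he0 : 0 < e := div_pos (by linarith) hk
    choose t ht using fun i => exists_lt_of_ciInf_lt (show ⨅ t, F i t < (⨅ t, F i t) + e by
      linarith)
    refine ⟨t, (Finset.sum_lt_sum_of_nonempty Finset.univ_nonempty fun i _ => ht i).trans_le ?_⟩
    rw [Finset.sum_add_distrib, Finset.sum_const, Finset.card_univ, nsmul_eq_mul, he,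
      mul_div_cancel₀ _ hk.ne']
    linarith
  · rintro ⟨t, ht⟩
    exact (Finset.sum_le_sum fun i _ => ciInf_le (hF i) (t i)).trans_lt ht

/-! ### Errors, divergences and domain adaptation -/

namespace FedGen

variable {X Y : Type*}

theorem zeroOneLoss_mem_Icc (y y' : Y) : zeroOneLoss y y' ∈ Set.Icc (0 : ℝ) 1 := by
  unfold zeroOneLoss
  split_ifs <;> simp

theorem empErr_nonneg {m : ℕ} (z : Fin m → X × Y) (h : X → Y) : 0 ≤ empErr z h :=
  mul_nonneg (by positivity) (Finset.sum_nonneg fun _ _ => (zeroOneLoss_mem_Icc _ _).1)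

theorem bddBelow_range_empErr {m : ℕ} (z : Fin m → X × Y) {ι : Type*} (F : ι → X → Y) :
    BddBelow (Set.range fun t => empErr z (F t)) :=
  ⟨0, by rintro _ ⟨t, rfl⟩; exact empErr_nonneg _ _⟩

/-- The probabilities of a disagreement set differ by at most half of the divergence, because the
supremum in the divergence is over a bounded set and so is a genuine least upper bound. -/
theorem abs_sub_le_half_divHDH [MeasurableSpace X] {H : Set (X → Y)} (D D' : Measure X)
    [IsProbabilityMeasure D] [IsProbabilityMeasure D'] {h h' : X → Y} (hh : h ∈ H)
    (hh' : h' ∈ H) :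
    |D.real {x | h x ≠ h' x} - D'.real {x | h x ≠ h' x}| ≤ 1 / 2 * divHDH H D D' := by
  unfold divHDH
  rw [← mul_assoc, one_div, inv_mul_cancel₀ (by norm_num), one_mul]
  refine le_ciSup (f := fun p : H × H =>
    |D.real {x | p.1.1 x ≠ p.2.1 x} - D'.real {x | p.1.1 x ≠ p.2.1 x}|)
    ⟨1, ?_⟩ (⟨h, hh⟩, ⟨h', hh'⟩)
  rintro _ ⟨p, rfl⟩
  exact abs_le.2 ⟨by linarith [measureReal_nonneg (μ := D) (s := {x | p.1.1 x ≠ p.2.1 x}),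
      measureReal_le_one (μ := D') (s := {x | p.1.1 x ≠ p.2.1 x})],
    by linarith [measureReal_nonneg (μ := D') (s := {x | p.1.1 x ≠ p.2.1 x}),
      measureReal_le_one (μ := D) (s := {x | p.1.1 x ≠ p.2.1 x})]⟩

theorem divHDH_mem_Icc [MeasurableSpace X] (H : Set (X → Y)) (D D' : Measure X)
    [IsProbabilityMeasure D] [IsProbabilityMeasure D'] : divHDH H D D' ∈ Set.Icc (0 : ℝ) 2 := by
  unfold divHDH
  constructor
  · exact mul_nonneg (by norm_num) (Real.iSup_nonneg fun p => abs_nonneg _)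
  · have : ⨆ p : H × H, |D.real {x | p.1.1 x ≠ p.2.1 x} - D'.real {x | p.1.1 x ≠ p.2.1 x}| ≤ 1 := by
      refine Real.iSup_le (fun p => abs_le.2 ⟨?_, ?_⟩) zero_le_one
      · linarith [measureReal_nonneg (μ := D) (s := {x | p.1.1 x ≠ p.2.1 x}),
          measureReal_le_one (μ := D') (s := {x | p.1.1 x ≠ p.2.1 x})]
      · linarith [measureReal_nonneg (μ := D') (s := {x | p.1.1 x ≠ p.2.1 x}),
          measureReal_le_one (μ := D) (s := {x | p.1.1 x ≠ p.2.1 x})]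
    linarith

section Measurability

variable [MeasurableSpace X] [MeasurableSpace Y]

theorem err_nonneg (P : ProbabilityMeasure (X × Y)) (h : X → Y) : 0 ≤ err P h :=
  integral_nonneg fun _ => (zeroOneLoss_mem_Icc _ _).1

theorem err_le_one (P : ProbabilityMeasure (X × Y)) (h : X → Y) : err P h ≤ 1 := by
  have h1 := integral_mono_of_nonneg (μ := (P : Measure (X × Y)))
    (f := fun z => zeroOneLoss (h z.1) z.2) (g := fun _ => (1 : ℝ))
    (Filter.Eventually.of_forall fun _ => (zeroOneLoss_mem_Icc _ _).1) (integrable_const _)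
    (Filter.Eventually.of_forall fun _ => (zeroOneLoss_mem_Icc _ _).2)
  simpa [err] using h1

theorem bddBelow_range_err (P : ProbabilityMeasure (X × Y)) {ι : Type*} (F : ι → X → Y) :
    BddBelow (Set.range fun t => err P (F t)) :=
  ⟨0, by rintro _ ⟨t, rfl⟩; exact err_nonneg _ _⟩

theorem errSpace_le_err (P : ProbabilityMeasure (X × Y)) {H : Set (X → Y)} {h : X → Y}
    (hh : h ∈ H) : errSpace P H ≤ err P h :=
  ciInf_le (bddBelow_range_err P fun h : H => h.1) ⟨h, hh⟩

theorem errSpace_mem_Icc (P : ProbabilityMeasure (X × Y)) (H : Set (X → Y)) :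
    errSpace P H ∈ Set.Icc (0 : ℝ) 1 := by
  refine ⟨Real.iInf_nonneg fun _ => err_nonneg _ _, ?_⟩
  rcases H.eq_empty_or_nonempty with rfl | ⟨h, hh⟩
  · simp [errSpace]
  · exact (errSpace_le_err P hh).trans (err_le_one _ _)

theorem bddBelow_range_jointErr (P P' : ProbabilityMeasure (X × Y)) {ι : Type*}
    (F : ι → X → Y) : BddBelow (Set.range fun t => err P (F t) + err P' (F t)) :=
  ⟨0, by rintro _ ⟨t, rfl⟩; exact add_nonneg (err_nonneg _ _) (err_nonneg _ _)⟩

theorem jointErr_mem_Icc (P P' : ProbabilityMeasure (X × Y)) (H : Set (X → Y)) :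
    jointErr H P P' ∈ Set.Icc (0 : ℝ) 2 := by
  refine ⟨Real.iInf_nonneg fun _ => add_nonneg (err_nonneg _ _) (err_nonneg _ _), ?_⟩
  rcases H.eq_empty_or_nonempty with rfl | ⟨h, hh⟩
  · simp [jointErr]
  · refine (ciInf_le (bddBelow_range_jointErr P P' fun h : H => h.1) ⟨h, hh⟩).trans ?_
    linarith [err_le_one P h, err_le_one P' h]

theorem iInf_range_eq {T α : Type*} (F : T → α) (φ : α → ℝ) :
    ⨅ h : Set.range F, φ h.1 = ⨅ t, φ (F t) :=
  (Set.rangeFactorization_surjective (f := F)).iInf_comp (fun h => φ h.1) |>.symm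

variable [MeasurableEq Y]

theorem measurable_zeroOneLoss : Measurable fun p : Y × Y => zeroOneLoss p.1 p.2 := by
  unfold zeroOneLoss
  exact Measurable.ite measurableSet_diagonal measurable_const measurable_const

theorem err_eq_real (P : ProbabilityMeasure (X × Y)) {h : X → Y} (hh : Measurable h) :
    err P h = (P : Measure (X × Y)).real {z | h z.1 ≠ z.2} := by
  have hs : MeasurableSet {z : X × Y | h z.1 ≠ z.2} :=
    (measurableSet_eq_fun (hh.comp measurable_fst) measurable_snd).compl
  rw [← integral_indicator_one hs]
  refine integral_congr_ae (Filter.Eventually.of_forall fun z => ?_)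
  by_cases hz : h z.1 = z.2 <;> simp [zeroOneLoss, hz]

theorem fst_real_eq (P : ProbabilityMeasure (X × Y)) {h h' : X → Y} (hh : Measurable h)
    (hh' : Measurable h') : (P : Measure (X × Y)).fst.real {x | h x ≠ h' x} =
      (P : Measure (X × Y)).real {z | h z.1 ≠ h' z.1} := by
  have hs : MeasurableSet {x | h x ≠ h' x} := (measurableSet_eq_fun hh hh').compl
  rw [measureReal_def, Measure.fst_apply hs]
  rfl

theorem err_le_err_add (P : ProbabilityMeasure (X × Y)) {h h' : X → Y} (hh : Measurable h)
    (hh' : Measurable h') :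
    err P h ≤ err P h' + (P : Measure (X × Y)).fst.real {x | h x ≠ h' x} := by
  rw [err_eq_real P hh, err_eq_real P hh', fst_real_eq P hh hh']
  refine (measureReal_mono fun z hz => ?_).trans (measureReal_union_le _ _)
  by_contra hc
  simp only [Set.mem_union, Set.mem_ofPred_eq, not_or, not_not] at hc
  exact hz (hc.2.trans hc.1)

theorem fst_real_le_err_add_err (P : ProbabilityMeasure (X × Y)) {h h' : X → Y}
    (hh : Measurable h) (hh' : Measurable h') :
    (P : Measure (X × Y)).fst.real {x | h x ≠ h' x} ≤ err P h + err P h' := by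
  rw [err_eq_real P hh, err_eq_real P hh', fst_real_eq P hh hh']
  refine (measureReal_mono fun z hz => ?_).trans (measureReal_union_le _ _)
  by_contra hc
  simp only [Set.mem_union, Set.mem_ofPred_eq, not_or, not_not] at hc
  exact hz (hc.1.trans hc.2.symm)

/-- Domain adaptation: two triangle inequalities through the joint hypothesis. -/
theorem err_le_err_add_divHDH_add_jointErr {H : Set (X → Y)} (hH : ∀ h ∈ H, Measurable h)
    (P Pnew : ProbabilityMeasure (X × Y)) {h : X → Y} (hh : h ∈ H) :
    err Pnew h ≤ err P h +
      1 / 2 * divHDH H (P : Measure (X × Y)).fst (Pnew : Measure (X × Y)).fst +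
      jointErr H P Pnew := by
  have : Nonempty H := ⟨⟨h, hh⟩⟩
  rw [← sub_le_iff_le_add']
  refine le_ciInf fun h' => ?_
  have h1 := err_le_err_add Pnew (hH h hh) (hH h' h'.2)
  have h2 := fst_real_le_err_add_err P (hH h hh) (hH h' h'.2)
  have h3 := (abs_le.1 (abs_sub_le_half_divHDH (P : Measure (X × Y)).fst
    (Pnew : Measure (X × Y)).fst hh h'.2)).1
  linarith

theorem measurable_err {A : Type*} [MeasurableSpace A] {G : A → X → Y}
    (hG : Measurable fun p : A × X => G p.1 p.2) :
    Measurable fun p : A × ProbabilityMeasure (X × Y) => err p.2 (G p.1) := by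
  have ht : MeasurableSet {q : (A × ProbabilityMeasure (X × Y)) × (X × Y) |
      G q.1.1 q.2.1 ≠ q.2.2} :=
    (measurableSet_eq_fun (hG.comp (measurable_fst.fst.prodMk measurable_snd.fst))
      measurable_snd.snd).compl
  have h := measurable_real_section
    (κ := fun p : A × ProbabilityMeasure (X × Y) => (p.2 : Measure (X × Y)))
    (measurable_subtype_coe.comp measurable_snd) ht
  convert! h using 2 with p
  exact err_eq_real p.2 (hG.comp measurable_prodMk_left)

theorem measurable_fst_real {A : Type*} [MeasurableSpace A] {G G' : A → X → Y}
    (hG : Measurable fun p : A × X => G p.1 p.2) (hG' : Measurable fun p : A × X => G' p.1 p.2) :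
    Measurable fun p : A × ProbabilityMeasure (X × Y) =>
      (p.2 : Measure (X × Y)).fst.real {x | G p.1 x ≠ G' p.1 x} := by
  have ht : MeasurableSet {q : (A × ProbabilityMeasure (X × Y)) × X |
      G q.1.1 q.2 ≠ G' q.1.1 q.2} :=
    (measurableSet_eq_fun (hG.comp (measurable_fst.fst.prodMk measurable_snd))
      (hG'.comp (measurable_fst.fst.prodMk measurable_snd))).compl
  exact measurable_real_section
    (κ := fun p : A × ProbabilityMeasure (X × Y) => (p.2 : Measure (X × Y)).fst)
    ((Measure.measurable_map _ measurable_fst).comp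
      (measurable_subtype_coe.comp measurable_snd)) ht

variable {T : Type*} [MeasurableSpace T] [StandardBorelSpace T] [Nonempty T]

theorem integrable_divHDH {F : T → X → Y} (hF : Measurable fun p : T × X => F p.1 p.2)
    (Q : Measure (ProbabilityMeasure (X × Y))) [IsProbabilityMeasure Q]
    (Pnew : ProbabilityMeasure (X × Y)) :
    Integrable (fun P : ProbabilityMeasure (X × Y) => divHDH (Set.range F)
      (P : Measure (X × Y)).fst (Pnew : Measure (X × Y)).fst) Q := by
  refine Integrable.of_mem_Icc 0 2 ?_ (Filter.Eventually.of_forall fun P => divHDH_mem_Icc _ _ _)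
  have hG : Measurable fun p : (T × T) × X => F p.1.1 p.2 :=
    hF.comp (measurable_fst.fst.prodMk measurable_snd)
  have hG' : Measurable fun p : (T × T) × X => F p.1.2 p.2 :=
    hF.comp (measurable_fst.snd.prodMk measurable_snd)
  have hm := measurable_fst_real (Y := Y) (G := fun t : T × T => F t.1)
    (G' := fun t : T × T => F t.2) hG hG'
  have hd : Measurable fun p : (T × T) × ProbabilityMeasure (X × Y) =>
      |(p.2 : Measure (X × Y)).fst.real {x | F p.1.1 x ≠ F p.1.2 x} -
        (Pnew : Measure (X × Y)).fst.real {x | F p.1.1 x ≠ F p.1.2 x}| :=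
    continuous_abs.measurable.comp
      (hm.sub (hm.comp (measurable_fst.prodMk measurable_const)))
  have hsup := aemeasurable_iSup_of_standardBorel Q (S := T × T) (F := fun t P =>
      |(P : Measure (X × Y)).fst.real {x | F t.1 x ≠ F t.2 x} -
        (Pnew : Measure (X × Y)).fst.real {x | F t.1 x ≠ F t.2 x}|) hd fun P => by
    refine ⟨1 / 2 * divHDH (Set.range F) (P : Measure (X × Y)).fst
      (Pnew : Measure (X × Y)).fst, ?_⟩
    rintro _ ⟨t, rfl⟩
    exact abs_sub_le_half_divHDH _ _ ⟨t.1, rfl⟩ ⟨t.2, rfl⟩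
  refine (hsup.const_mul 2).congr (Filter.Eventually.of_forall fun P => ?_)
  have hsurj : Function.Surjective (Prod.map (Set.rangeFactorization F)
      (Set.rangeFactorization F)) :=
    Set.rangeFactorization_surjective.prodMap Set.rangeFactorization_surjective
  simp only [divHDH]
  rw [← hsurj.iSup_comp]
  rfl

theorem integrable_jointErr {F : T → X → Y} (hF : Measurable fun p : T × X => F p.1 p.2)
    (Q : Measure (ProbabilityMeasure (X × Y))) [IsProbabilityMeasure Q]
    (Pnew : ProbabilityMeasure (X × Y)) :
    Integrable (fun P => jointErr (Set.range F) P Pnew) Q := by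
  refine Integrable.of_mem_Icc 0 2 ?_
    (Filter.Eventually.of_forall fun P => jointErr_mem_Icc _ _ _)
  have hm := measurable_err hF
  refine (aemeasurable_iInf_of_standardBorel Q (S := T)
    (F := fun t P => err P (F t) + err Pnew (F t))
    (hm.add (hm.comp (measurable_fst.prodMk measurable_const)))
    fun P => bddBelow_range_jointErr P Pnew F).congr (Filter.Eventually.of_forall fun P => ?_)
  exact (iInf_range_eq F fun h => err P h + err Pnew h).symm

end Measurability

/-! ### Uniform generalization over the training clients -/

theorem exists_cover_of_coverNum_le {α : Type*} {d : α → α → ℝ} {A : Set α} {r : ℝ} {N : ℕ}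
    (h : coverNum d A r ≤ N) :
    ∃ C ⊆ A, C.encard ≤ N ∧ ∀ a ∈ A, ∃ c ∈ C, d a c ≤ r := by
  have h1 : coverNum d A r < (N : ℕ∞) + 1 :=
    h.trans_lt ((ENat.lt_add_one_iff (ENat.natCast_ne_top N)).2 le_rfl)
  simp only [coverNum, iInf_lt_iff] at h1
  obtain ⟨C, hCA, hC, hlt⟩ := h1
  exact ⟨C, hCA, (ENat.lt_add_one_iff (ENat.natCast_ne_top N)).1 hlt, hC⟩

/-- A cover of a parametrized set gives a cover of the parameter space. -/
theorem exists_finset_cover_of_coverNum_le {α Θ : Type*} {d : α → α → ℝ} {p : Θ → α} {r : ℝ}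
    {N : ℕ} (h : coverNum d (Set.range p) r ≤ N) :
    ∃ C : Finset Θ, C.card ≤ N ∧ ∀ θ, ∃ c ∈ C, d (p θ) (p c) ≤ r := by
  classical
  obtain ⟨C, hCA, hCN, hC⟩ := exists_cover_of_coverNum_le h
  have hfin : C.Finite := Set.finite_of_encard_le_coe hCN
  choose q hq using fun c : C => hCA c.2
  have := hfin.fintype
  refine ⟨Finset.univ.image q, Finset.card_image_le.trans ?_, fun θ => ?_⟩
  · rw [Set.encard_eq_coe_toFinset_card, Nat.cast_le, Set.toFinset_card] at hCN
    simpa using hCN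
  · obtain ⟨c, hc, hd⟩ := hC (p θ) ⟨θ, rfl⟩
    exact ⟨q ⟨c, hc⟩, Finset.mem_image_of_mem _ (Finset.mem_univ _), by rwa [hq]⟩

section Deviation

variable [MeasurableSpace X] [MeasurableSpace Y] {S T : Type*} [MeasurableSpace S]
  {f : S → T → X → Y}

theorem measurable_zeroOneLoss_param [MeasurableEq Y] [MeasurableSpace T]
    (hf : Measurable fun p : S × T × X => f p.1 p.2.1 p.2.2) {A : Type*} [MeasurableSpace A]
    {s : A → S} {t : A → T} {z : A → X × Y} (hs : Measurable s) (ht : Measurable t)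
    (hz : Measurable z) : Measurable fun a => zeroOneLoss (f (s a) (t a) (z a).1) (z a).2 := by
  have h : Measurable fun a => f (s a) (t a) (z a).1 :=
    hf.comp (hs.prodMk (ht.prodMk hz.fst))
  exact measurable_zeroOneLoss.comp (h.prodMk hz.snd)

/-- With high probability the training clients are representative: uniformly over the family,
`err_Q(H)` exceeds the average of `err_{P_i}(H)` by at most `ε / 2`. -/
theorem measure_exists_errQ_deviation_le [StandardBorelSpace S]
    (hf : Measurable fun p : S × ProbabilityMeasure (X × Y) =>
      errSpace p.2 (Set.range (f p.1)))
    (Q : Measure (ProbabilityMeasure (X × Y))) [IsProbabilityMeasure Q]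
    {ε δ : ℝ} (hε : 0 < ε) (hδ : 0 < δ) {n N : ℕ}
    (hcap : capStar (Set.range fun s => Set.range (f s)) (ε / 32) ≤ N)
    (hn : 64 / ε ^ 2 ≤ (n : ℝ)) (hnN : 256 / ε ^ 2 * Real.log (8 * N / δ) ≤ n) :
    (Measure.pi fun _ : Fin n => Q) {P | ∃ s, ε / 2 < errQ Q (Set.range (f s)) -
      1 / (n : ℝ) * ∑ i, errSpace (P i) (Set.range (f s))} ≤ ENNReal.ofReal (δ / 2) := by
  have hn0 : (0 : ℝ) < n := lt_of_lt_of_le (by positivity) hn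
  have : Nonempty (Fin n) := Fin.pos_iff_nonempty.1 (Nat.cast_pos.1 hn0)
  have h := measure_pi_exists_half_eps_deviation_le (fun _ : Fin n => Q)
    (g := fun s _ P => errSpace P (Set.range (f s))) (fun _ => hf)
    (fun s _ P => errSpace_mem_Icc P _) hε hδ N (by simpa using hn) (by simpa using hnN) ?_
  · refine (measure_mono ?_).trans h
    rintro P ⟨s, hs⟩
    refine ⟨s, ?_⟩
    rw [one_div, ← div_eq_inv_mul, lt_sub_iff_add_lt, ← lt_sub_iff_add_lt',
      div_lt_iff₀ hn0] at hs
    simp only [Finset.sum_const, Finset.card_univ, Fintype.card_fin, nsmul_eq_mul]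
    change _ < n * errQ Q (Set.range (f s)) - _
    linarith
  · intro w
    obtain ⟨Q', hQ'⟩ := exists_empirical_probabilityMeasure w
    obtain ⟨C, hCN, hC⟩ := exists_finset_cover_of_coverNum_le
      ((le_iSup (fun Q' : ProbabilityMeasure (ProbabilityMeasure (X × Y)) =>
        coverNum (spaceDist (Q' : Measure (ProbabilityMeasure (X × Y))))
          (Set.range fun s => Set.range (f s)) (ε / 32)) Q').trans hcap)
    refine ⟨C, hCN, fun s => ?_⟩
    obtain ⟨c, hc, hd⟩ := hC s
    refine ⟨c, hc, ?_⟩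
    have hm : ∀ s, Measurable fun P : ProbabilityMeasure (X × Y) =>
        errSpace P (Set.range (f s)) := fun s => hf.comp measurable_prodMk_left
    rw [spaceDist, hQ' (fun P => |errSpace P (Set.range (f s)) - errSpace P (Set.range (f c))|)
      (continuous_abs.measurable.comp ((hm s).sub (hm c))), one_div,
      ← div_eq_inv_mul, div_le_iff₀ (by simpa using hn0)] at hd
    simp only [Fintype.card_fin] at hd ⊢
    linarith

/-- For fixed clients, with high probability the average of `err_{P_i}(H)` exceeds the multitask
empirical error by at most `ε / 2`, uniformly over the family. -/
theorem measure_exists_empErrSpace_deviation_le [MeasurableEq Y] [StandardBorelSpace S]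
    [MeasurableSpace T] [StandardBorelSpace T] [Nonempty T]
    (hf : Measurable fun p : S × T × X => f p.1 p.2.1 p.2.2) {n m N : ℕ}
    (P : Fin n → ProbabilityMeasure (X × Y)) {ε δ : ℝ} (hε : 0 < ε) (hδ : 0 < δ)
    (hcap : capTuples (Set.range fun s => Set.range (f s)) n (ε / 32) ≤ N)
    (hn : 0 < n) (hm : 64 / ε ^ 2 ≤ (m : ℝ))
    (hmN : 256 / (n * ε ^ 2) * Real.log (8 * N / δ) ≤ m) :
    (Measure.pi fun i => Measure.pi fun _ : Fin m => (P i : Measure (X × Y)))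
      {z | ∃ s, ε / 2 < 1 / (n : ℝ) * ∑ i, errSpace (P i) (Set.range (f s)) -
        empErrSpace z (Set.range (f s))} ≤ ENNReal.ofReal (δ / 2) := by
  have hm0 : (0 : ℝ) < m := lt_of_lt_of_le (by positivity) hm
  have hn0 : (0 : ℝ) < n := Nat.cast_pos.2 hn
  have hn1 : (1 : ℝ) ≤ n := Nat.one_le_cast.2 hn
  have : Nonempty (Fin m) := Fin.pos_iff_nonempty.1 (Nat.cast_pos.1 hm0)
  have hloss : ∀ i, Measurable fun p : (S × (Fin n → T)) × (X × Y) =>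
      zeroOneLoss (f p.1.1 (p.1.2 i) p.2.1) p.2.2 := fun i =>
    measurable_zeroOneLoss_param hf measurable_fst.fst
      ((measurable_pi_apply i).comp measurable_fst.snd) measurable_snd
  rw [pi_pi_apply_eq_pi_prod]
  have h := measure_pi_exists_half_eps_deviation_le
    (fun p : Fin n × Fin m => (P p.1 : Measure (X × Y)))
    (g := fun (θ : S × (Fin n → T)) p z => zeroOneLoss (f θ.1 (θ.2 p.1) z.1) z.2)
    (fun p => hloss p.1) (fun _ _ _ => zeroOneLoss_mem_Icc _ _) hε hδ N
    (by
      simp only [Fintype.card_prod, Fintype.card_fin, Nat.cast_mul]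
      nlinarith)
    (by
      simp only [Fintype.card_prod, Fintype.card_fin, Nat.cast_mul]
      rw [div_mul_eq_mul_div, div_le_iff₀ (by positivity)] at hmN ⊢
      linarith) ?_
  · refine (measure_mono ?_).trans h
    rintro z ⟨s, hs⟩
    set c := ∑ i, errSpace (P i) (Set.range (f s)) with hc
    have h1 : ∑ i, ⨅ t, empErr (fun j => z (i, j)) (f s t) < c - n * (ε / 2) := by
      have h2 : empErrSpace (fun i j => z (i, j)) (Set.range (f s)) =
          (∑ i, ⨅ t, empErr (fun j => z (i, j)) (f s t)) / n := by
        simp only [empErrSpace, iInf_range_eq]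
        ring
      rw [h2, one_div, ← div_eq_inv_mul, ← sub_div, lt_div_iff₀ hn0] at hs
      linarith
    obtain ⟨t, ht⟩ := (sum_iInf_lt_iff fun i => bddBelow_range_empErr _ (f s)).1 h1
    refine ⟨(s, t), ?_⟩
    simp only [Fintype.card_prod, Fintype.card_fin, Nat.cast_mul, Fintype.sum_prod_type,
      Finset.sum_const, Finset.card_univ, nsmul_eq_mul]
    have h3 : c ≤ ∑ i, err (P i) (f s (t i)) :=
      Finset.sum_le_sum fun i _ => errSpace_le_err (P i) ⟨t i, rfl⟩
    have h4 : ∑ i, empErr (fun j => z (i, j)) (f s (t i)) =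
        (∑ i, ∑ j, zeroOneLoss (f s (t i) (z (i, j)).1) (z (i, j)).2) / m := by
      simp only [empErr]
      rw [← Finset.mul_sum]
      ring
    rw [h4, div_lt_iff₀ hm0] at ht
    have h5 : ∑ i : Fin n, (m : ℝ) * ∫ z, zeroOneLoss (f s (t i) z.1) z.2
        ∂(P i : Measure (X × Y)) = m * ∑ i, err (P i) (f s (t i)) := by
      rw [Finset.mul_sum]
      rfl
    rw [h5]
    nlinarith
  · intro w
    choose P' hP' using fun i => exists_empirical_probabilityMeasure fun j => w (i, j)
    have hrange : tuples (Set.range fun s => Set.range (f s)) n =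
        Set.range fun (θ : S × (Fin n → T)) i => f θ.1 (θ.2 i) := by
      ext h
      constructor
      · rintro ⟨_, ⟨s, rfl⟩, hH⟩
        choose t ht using hH
        exact ⟨(s, t), funext ht⟩
      · rintro ⟨θ, rfl⟩
        exact ⟨_, ⟨θ.1, rfl⟩, fun i => ⟨θ.2 i, rfl⟩⟩
    have hcap' := (le_iSup (fun P' : Fin n → ProbabilityMeasure (X × Y) =>
      coverNum (tupleDist P') (tuples (Set.range fun s => Set.range (f s)) n) (ε / 32))
      P').trans hcap
    rw [hrange] at hcap'
    obtain ⟨C, hCN, hC⟩ := exists_finset_cover_of_coverNum_le hcap'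
    refine ⟨C, hCN, fun θ => ?_⟩
    obtain ⟨c, hc, hd⟩ := hC θ
    refine ⟨c, hc, ?_⟩
    have hθ : ∀ (θ : S × (Fin n → T)) i, Measurable fun z : X × Y =>
        zeroOneLoss (f θ.1 (θ.2 i) z.1) z.2 := fun θ i =>
      (hloss i).comp measurable_prodMk_left
    rw [tupleDist, Finset.sum_congr rfl fun i _ => hP' i
      (fun z => |zeroOneLoss (f θ.1 (θ.2 i) z.1) z.2 - zeroOneLoss (f c.1 (c.2 i) z.1) z.2|)
      (continuous_abs.measurable.comp ((hθ θ i).sub (hθ c i))), ← Finset.mul_sum,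
      ← mul_assoc, one_div, one_div, ← mul_inv, ← div_eq_inv_mul,
      div_le_iff₀ (by simp only [Fintype.card_fin]; positivity)] at hd
    simp only [Fintype.card_prod, Fintype.card_fin, Nat.cast_mul,
      Fintype.sum_prod_type] at hd ⊢
    refine le_trans hd (le_of_eq ?_)
    ring

/-- The samples on which some space of the family violates the generalization bound form a
universally measurable set, as a projection along the parameters. -/
theorem nullMeasurableSet_exists_empErrSpace_add_lt [MeasurableEq Y] [StandardBorelSpace S]
    [MeasurableSpace T] [StandardBorelSpace T] [Nonempty T]
    (hf : Measurable fun p : S × T × X => f p.1 p.2.1 p.2.2)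
    (hf' : Measurable fun p : S × ProbabilityMeasure (X × Y) =>
      errSpace p.2 (Set.range (f p.1)))
    (Q : Measure (ProbabilityMeasure (X × Y))) [IsProbabilityMeasure Q] {n m : ℕ} (hn : 0 < n)
    (ε : ℝ) (ρ : Measure (Fin n → Fin m → X × Y)) [IsFiniteMeasure ρ] :
    NullMeasurableSet {z | ∃ s, empErrSpace z (Set.range (f s)) + ε <
      errQ Q (Set.range (f s))} ρ := by
  have hn0 : (0 : ℝ) < n := Nat.cast_pos.2 hn
  have hE : MeasurableSet {p : (S × (Fin n → T)) × (Fin n → Fin m → X × Y) |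
      ∑ i, empErr (p.2 i) (f p.1.1 (p.1.2 i)) < n * (errQ Q (Set.range (f p.1.1)) - ε)} := by
    refine measurableSet_lt ?_ ?_
    · refine Finset.measurable_sum _ fun i _ => (Finset.measurable_sum _ fun j _ => ?_).const_mul _
      have hz : Measurable fun p : (S × (Fin n → T)) × (Fin n → Fin m → X × Y) => p.2 i j :=
        (measurable_pi_apply j).comp ((measurable_pi_apply i).comp measurable_snd)
      exact measurable_zeroOneLoss_param hf measurable_fst.fst
        ((measurable_pi_apply i).comp measurable_fst.snd) hz
    · have hQ : Measurable fun s => errQ Q (Set.range (f s)) :=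
        (StronglyMeasurable.integral_prod_right hf'.stronglyMeasurable).measurable
      exact ((hQ.comp measurable_fst.fst).sub_const _).const_mul _
  convert! hE.nullMeasurableSet_exists ρ using 1
  ext z
  simp only [Set.mem_ofPred_eq, Prod.exists]
  refine exists_congr fun s => ?_
  rw [← sum_iInf_lt_iff fun i => bddBelow_range_empErr _ (f s), ← lt_sub_iff_add_lt,
    ← div_lt_iff₀' hn0]
  simp only [empErrSpace, iInf_range_eq]
  rw [one_div, ← div_eq_inv_mul]

theorem measurable_pi_probabilityMeasure (m : ℕ) :
    Measurable fun P : ProbabilityMeasure (X × Y) =>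
      Measure.pi fun _ : Fin m => (P : Measure (X × Y)) :=
  measurable_measure_pi (κ := fun (_ : Fin m) (P : ProbabilityMeasure (X × Y)) =>
    (P : Measure (X × Y))) fun _ => measurable_subtype_coe

/-- Uniform generalization from the training clients: with probability at least `1 - δ`, the
multitask error exceeds the multitask empirical error by at most `ε` for every hypothesis space of
the family. -/
theorem sampleLaw_exists_empErrSpace_add_lt_le [MeasurableEq Y] [StandardBorelSpace S]
    [MeasurableSpace T] [StandardBorelSpace T] [Nonempty T]
    (hf : Measurable fun p : S × T × X => f p.1 p.2.1 p.2.2)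
    (hf' : Measurable fun p : S × ProbabilityMeasure (X × Y) =>
      errSpace p.2 (Set.range (f p.1)))
    (Q : Measure (ProbabilityMeasure (X × Y))) [IsProbabilityMeasure Q]
    {ε δ : ℝ} (hε : 0 < ε) (hδ : 0 < δ) {n m N N' : ℕ}
    (hcap : capStar (Set.range fun s => Set.range (f s)) (ε / 32) ≤ N)
    (hcap' : capTuples (Set.range fun s => Set.range (f s)) n (ε / 32) ≤ N')
    (hn : 64 / ε ^ 2 ≤ (n : ℝ)) (hnN : 256 / ε ^ 2 * Real.log (8 * N / δ) ≤ n)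
    (hm : 64 / ε ^ 2 ≤ (m : ℝ)) (hmN : 256 / (n * ε ^ 2) * Real.log (8 * N' / δ) ≤ m) :
    sampleLaw Q n m {z | ∃ s, empErrSpace z (Set.range (f s)) + ε <
      errQ Q (Set.range (f s))} ≤ ENNReal.ofReal δ := by
  have hn0 : 0 < n := Nat.cast_pos.1 (lt_of_lt_of_le (by positivity : 0 < 64 / ε ^ 2) hn)
  have hκ := measurable_pi_probabilityMeasure (X := X) (Y := Y) m
  have hκn : Measurable fun P : Fin n → ProbabilityMeasure (X × Y) =>
      Measure.pi fun i => Measure.pi fun _ : Fin m => (P i : Measure (X × Y)) :=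
    measurable_measure_pi (κ := fun i (P : Fin n → ProbabilityMeasure (X × Y)) =>
      Measure.pi fun _ : Fin m => (P i : Measure (X × Y)))
      fun i => hκ.comp (measurable_pi_apply i)
  have hlaw : sampleLaw Q n m = (Measure.pi fun _ : Fin n => Q).bind fun P =>
      Measure.pi fun i => Measure.pi fun _ : Fin m => (P i : Measure (X × Y)) :=
    pi_bind_eq_bind_pi Q hκ
  have : IsProbabilityMeasure (sampleLaw Q n m) := by
    rw [hlaw]
    exact isProbabilityMeasure_bind hκn.aemeasurable (Filter.Eventually.of_forall inferInstance)
  have hnull := nullMeasurableSet_exists_empErrSpace_add_lt hf hf' Q hn0 ε (sampleLaw Q n m)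
  rw [hlaw] at hnull ⊢
  rw [← add_halves δ, ENNReal.ofReal_add (by positivity) (by positivity)]
  refine bind_apply_le_add _ hκn hnull
    (measure_exists_errQ_deviation_le hf' Q hε hδ hcap hn hnN) fun P hP => ?_
  refine (measure_mono ?_).trans
    (measure_exists_empErrSpace_deviation_le hf P hε hδ hcap' hn0 hm hmN)
  rintro z ⟨s, hs⟩
  refine ⟨s, ?_⟩
  simp only [Set.mem_ofPred_eq, not_exists, not_lt] at hP
  linarith [hP s]

end Deviation

end FedGen

/-! ### Generalization to novel clients -/

open FedGen in
theorem theorem1 {X Y : Type*} [MeasurableSpace X] [MeasurableSpace Y] [MeasurableEq Y]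
    (Q : Measure (ProbabilityMeasure (X × Y))) [IsProbabilityMeasure Q]
    (ℍ : Set (Set (X → Y))) (hℍ : Permissible ℍ)
    (ε δ : ℝ) (hε : 0 < ε) (hδ : 0 < δ) (n m : ℕ)
    (hC : capStar ℍ (ε / 32) ≠ ⊤) (hC' : capTuples ℍ n (ε / 32) ≠ ⊤)
    (hn : max (256 / ε ^ 2 * Real.log (8 * ((capStar ℍ (ε / 32)).toNat : ℝ) / δ))
      (64 / ε ^ 2) ≤ (n : ℝ))
    (hm : max (256 / ((n : ℝ) * ε ^ 2)
        * Real.log (8 * ((capTuples ℍ n (ε / 32)).toNat : ℝ) / δ))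
      (64 / ε ^ 2) ≤ (m : ℝ)) :
    -- the quantities that are averaged over `Q` are integrable, and domain adaptation holds
    -- for every hypothesis
    (∀ H ∈ ℍ, Integrable (fun P => errSpace P H) Q ∧
      ∀ Pnew : ProbabilityMeasure (X × Y),
        Integrable (fun P : ProbabilityMeasure (X × Y) =>
          divHDH H (P : Measure (X × Y)).fst (Pnew : Measure (X × Y)).fst) Q ∧
        Integrable (fun P => jointErr H P Pnew) Q ∧
        ∀ P : ProbabilityMeasure (X × Y), ∀ h ∈ H,
          err Pnew h ≤ err P h
            + 1 / 2 * divHDH H (P : Measure (X × Y)).fst (Pnew : Measure (X × Y)).fst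
            + jointErr H P Pnew) ∧
    -- the set of bad samples has (outer) probability at most `δ`
    sampleLaw Q n m {z | ¬ ∀ H ∈ ℍ,
      errQ Q H ≤ empErrSpace z H + ε ∧
      ∀ Pnew : ProbabilityMeasure (X × Y),
        -- the novel client uses a hypothesis that is near-optimal for a random client
        (∀ (η : ℝ) (g : ProbabilityMeasure (X × Y) → X → Y),
          (∀ᵐ P ∂Q, g P ∈ H ∧ err P (g P) ≤ errSpace P H + η) →
          Integrable (fun P => err Pnew (g P)) Q →
          ∫ P, err Pnew (g P) ∂Q ≤ empErrSpace z H + ε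
            + 1 / 2 * ∫ P : ProbabilityMeasure (X × Y),
                divHDH H (P : Measure (X × Y)).fst (Pnew : Measure (X × Y)).fst ∂Q
            + ∫ P, jointErr H P Pnew ∂Q + η) ∧
        -- the error of the hypothesis space on the novel client
        errSpace Pnew H ≤ empErrSpace z H + ε
          + 1 / 2 * ∫ P : ProbabilityMeasure (X × Y),
              divHDH H (P : Measure (X × Y)).fst (Pnew : Measure (X × Y)).fst ∂Q
          + ∫ P, jointErr H P Pnew ∂Q ∧
        -- the same without the `λ` term when it vanishes
        ((∀ᵐ P ∂Q, jointErr H P Pnew = 0) →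
          errSpace Pnew H ≤ empErrSpace z H + ε
            + 1 / 2 * ∫ P : ProbabilityMeasure (X × Y),
                divHDH H (P : Measure (X × Y)).fst (Pnew : Measure (X × Y)).fst ∂Q)}
      ≤ ENNReal.ofReal δ := by
  obtain ⟨S, T, _, _, _, _, _, f, hf, hf', rfl⟩ := hℍ
  have hfs : ∀ s, Measurable fun p : T × X => f s p.1 p.2 := fun s =>
    hf.comp measurable_prodMk_left
  have hH : ∀ s, ∀ h ∈ Set.range (f s), Measurable h := by
    rintro s _ ⟨t, rfl⟩
    exact (hfs s).comp measurable_prodMk_left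
  have hint : ∀ s, Integrable (fun P => errSpace P (Set.range (f s))) Q := fun s =>
    Integrable.of_mem_Icc 0 1 (hf'.comp measurable_prodMk_left).aemeasurable
      (Filter.Eventually.of_forall fun P => errSpace_mem_Icc P _)
  refine ⟨?_, ?_⟩
  · rintro _ ⟨s, rfl⟩
    exact ⟨hint s, fun Pnew => ⟨integrable_divHDH (hfs s) Q Pnew,
      integrable_jointErr (hfs s) Q Pnew, fun P h hh =>
        err_le_err_add_divHDH_add_jointErr (hH s) P Pnew hh⟩⟩
  -- the bad samples are those on which the multitask error is underestimated; the bounds for the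
  -- novel client then hold deterministically
  refine (measure_mono ?_).trans (sampleLaw_exists_empErrSpace_add_lt_le hf hf' Q hε hδ
    (ENat.natCast_toNat hC).ge (ENat.natCast_toNat hC').ge ((le_max_right _ _).trans hn)
    ((le_max_left _ _).trans hn) ((le_max_right _ _).trans hm) ((le_max_left _ _).trans hm))
  intro z hz
  by_contra hgood
  simp only [Set.mem_ofPred_eq, not_exists, not_lt] at hgood
  refine hz ?_
  rintro _ ⟨s, rfl⟩
  have hd := fun Pnew => integrable_divHDH (hfs s) Q Pnew
  have hj := fun Pnew => integrable_jointErr (hfs s) Q Pnew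
  have hA : ∀ Pnew : ProbabilityMeasure (X × Y), errSpace Pnew (Set.range (f s)) ≤
      empErrSpace z (Set.range (f s)) + ε + 1 / 2 * ∫ P : ProbabilityMeasure (X × Y),
        divHDH (Set.range (f s)) (P : Measure (X × Y)).fst (Pnew : Measure (X × Y)).fst ∂Q +
        ∫ P, jointErr (Set.range (f s)) P Pnew ∂Q := by
    intro Pnew
    have hpt : ∀ P : ProbabilityMeasure (X × Y), errSpace Pnew (Set.range (f s)) ≤
        errSpace P (Set.range (f s)) + 0 +
        1 / 2 * divHDH (Set.range (f s)) (P : Measure (X × Y)).fst (Pnew : Measure (X × Y)).fst +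
        jointErr (Set.range (f s)) P Pnew := by
      intro P
      rw [add_zero, add_assoc, ← sub_le_iff_le_add]
      refine le_ciInf fun h => ?_
      have h1 := err_le_err_add_divHDH_add_jointErr (hH s) P Pnew h.2
      have h2 := errSpace_le_err Pnew h.2
      linarith
    have h := integral_le_add_of_ae_le (integrable_const _) (hint s) (hd Pnew) (hj Pnew)
      (Filter.Eventually.of_forall hpt)
    simp only [integral_const, probReal_univ, one_smul] at h
    have hs := hgood s
    rw [errQ] at hs
    linarith
  refine ⟨hgood s, fun Pnew => ⟨fun η g hg hgint => ?_, hA Pnew, fun h0 => ?_⟩⟩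
  · have hpt : ∀ᵐ P ∂Q, err Pnew (g P) ≤ errSpace P (Set.range (f s)) + η +
        1 / 2 * divHDH (Set.range (f s)) (P : Measure (X × Y)).fst (Pnew : Measure (X × Y)).fst +
        jointErr (Set.range (f s)) P Pnew := by
      filter_upwards [hg] with P hP
      have h1 := err_le_err_add_divHDH_add_jointErr (hH s) P Pnew hP.1
      have h2 := hP.2
      linarith
    have h := integral_le_add_of_ae_le hgint (hint s) (hd Pnew) (hj Pnew) hpt
    have hs := hgood s
    rw [errQ] at hs
    linarith
  · have h := hA Pnew
    rwa [integral_eq_zero_of_ae h0, add_zero] at h
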